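/- Let $K$ be a locally compact hypergroup: a locally compact Hausdorff space with regular Borel probability measures $\delta_x*\delta_y$ of compact support ($x,y\in K$) such that $(x,y)\mapsto\delta_x*\delta_y$ is weakly continuous, $(x,y)\mapsto\operatorname{supp}(\delta_x*\delta_y)$ is continuous for the Michael (Vietoris) topology, the convolution is associative, there is an identity $e$ with $\delta_e*\delta_x=\delta_x*\delta_e=\delta_x$, and there is a continuous involution $x\mapsto\check x$ with $(\delta_x*\delta_y)\check{}=\delta_{\check y}*\delta_{\check x}$ and $e\in\operatorname{supp}(\delta_x*\delta_y)\iff x=\check y$. Write $f(x*y)=\int_K f\,d(\delta_x*\delta_y)$, and let $M(K)$ be the space of bounded regular complex Borel measures on $K$, with the convolution $\int f\,d(\mu*\nu)=\int\!\!\int f(x*y)\,d\mu(x)\,d\nu(y)$ for $f\in C_0(K)$. For $A,B\subseteq K$ put $A*B=\bigcup_{x\in A,\,y\in B}\operatorname{supp}(\delta_x*\delta_y)$, and let $A^n$ be the $n$-fold product of $A$ with itself. Suppose that $K$ is non-compact, and let $\sigma$ be a regular Borel probability measure on $K$ that is non-degenerate, i.e. $K=\overline{\bigcup_{n\ge1}(\operatorname{supp}\sigma)^n}$.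 Then: (a) $H_\sigma(K):=\{\mu\in M(K):\sigma*\mu=\mu\}=\{0\}$; (b) for every left Haar measure $\omega$ on $K$ (a non-zero positive Radon measure with $\int f(x*y)\,d\omega(y)=\int f\,d\omega$ for all $x\in K$ and $f\in C_c(K)$), $H^1_\sigma(K):=\{f\in L^1(K,\omega):\sigma*f=f\ \ \omega\text{-a.e.}\}=\{0\}$, where $(\sigma*f)(x)=\int_K f(\check y*x)\,d\sigma(y)$. -/

import Mathlib

open MeasureTheory Topology
open scoped BoundedContinuousFunction ZeroAtInfty CompactlySupported

/-- A (locally compact) hypergroup.  The convolution is recorded on point masses: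
`conv x y` is the regular probability measure `δ_x * δ_y`.  Its extension to bounded regular
complex measures is given by `⟨μ * ν, f⟩ = ∫ ∫ ⟨δ_x * δ_y, f⟩ dμ(x) dν(y)`,
see `Hypergroup.IsConv`; `conv_assoc` is the associativity
`(δ_x * δ_y) * δ_z = δ_x * (δ_y * δ_z)`, tested against bounded continuous functions. -/
class Hypergroup (K : Type*) [TopologicalSpace K] [T2Space K] [LocallyCompactSpace K]
    [MeasurableSpace K] [BorelSpace K] where
  /-- `δ_x * δ_y`. -/
  conv : K → K → ProbabilityMeasure K
  /-- The identity element. -/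
  e : K
  /-- The involution `x ↦ x̌`. -/
  inv : K → K
  conv_regular : ∀ x y, (conv x y : Measure K).Regular
  isCompact_support_conv : ∀ x y, IsCompact (conv x y : Measure K).support
  /-- Continuity of `(x, y) ↦ supp (δ_x * δ_y)` for the Michael (Vietoris) topology, generated by
  the sets `{C | C ⊆ U}` and `{C | C ∩ U ≠ ∅}` with `U` open. -/
  continuous_support_conv :
    @Continuous (K × K) (Set K) inferInstance (TopologicalSpace.vietoris K)
      (fun p => (conv p.1 p.2 : Measure K).support)
  /-- Continuity of `(x, y) ↦ δ_x * δ_y` for the weak topology on probability measures. -/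
  continuous_conv : Continuous (fun p : K × K => conv p.1 p.2)
  conv_assoc : ∀ (x y z : K) (f : K →ᵇ ℂ),
    ∫ t, (∫ s, f s ∂(conv t z : Measure K)) ∂(conv x y : Measure K) =
      ∫ t, (∫ s, f s ∂(conv x t : Measure K)) ∂(conv y z : Measure K)
  e_conv : ∀ x, (conv e x : Measure K) = Measure.dirac x
  conv_e : ∀ x, (conv x e : Measure K) = Measure.dirac x
  continuous_inv : Continuous inv
  inv_inv : ∀ x, inv (inv x) = x
  map_inv_conv : ∀ x y, (conv x y : Measure K).map inv = (conv (inv y) (inv x) : Measure K)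
  e_mem_support_conv : ∀ x y, e ∈ (conv x y : Measure K).support ↔ x = inv y

namespace Hypergroup

noncomputable section

variable {K : Type*} [TopologicalSpace K] [T2Space K] [LocallyCompactSpace K]
  [MeasurableSpace K] [BorelSpace K] [Hypergroup K]

/-- `f(x * y) = ∫ f d(δ_x * δ_y)`. -/
def translate (f : K → ℂ) (x y : K) : ℂ := ∫ t, f t ∂(conv x y : Measure K)

/-- The product of sets `A * B = ⋃_{x ∈ A, y ∈ B} supp (δ_x * δ_y)`. -/
def setMul (A B : Set K) : Set K := ⋃ x ∈ A, ⋃ y ∈ B, (conv x y : Measure K).support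

/-- `setPowSucc A n` is the power `A ^ (n + 1)` for `setMul`, so that `setPowSucc A 0 = A`. -/
def setPowSucc (A : Set K) : ℕ → Set K
  | 0 => A
  | n + 1 => setMul (setPowSucc A n) A

/-- A positive measure `σ` is non-degenerate if `⋃_{n ≥ 1} (supp σ)^n` is dense in `K`. -/
def IsNondegenerate (σ : Measure K) : Prop :=
  closure (⋃ n : ℕ, setPowSucc σ.support n) = Set.univ

/-- `μ` belongs to `M(K)`, i.e. the complex Borel measure `μ` is regular: its total variation
measure `|μ|` is.  (Boundedness is automatic for complex measures.) -/
def IsRegularMeasure (μ : ComplexMeasure K) : Prop := μ.variation.Regular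

/-- The integral `∫ f dμ` of a complex function against a complex measure. -/
def cintegral (μ : ComplexMeasure K) (f : K → ℂ) : ℂ :=
  μ.integral f (ContinuousLinearMap.mul ℝ ℂ)

/-- `τ = σ * μ` in `M(K)` for a (finite positive) measure `σ` and a complex measure `μ`:
`∫ f dτ = ∫ (∫ f(x * y) dσ(x)) dμ(y)` for all `f ∈ C₀(K)`. -/
def IsConv (σ : Measure K) (μ τ : ComplexMeasure K) : Prop :=
  IsRegularMeasure τ ∧
    ∀ f : C₀(K, ℂ), cintegral τ f = cintegral μ (fun y => ∫ x, translate f x y ∂σ)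

/-- `H_σ(K)`: the bounded regular complex measures `μ` with `σ * μ = μ`. -/
def harmonicMeasures (σ : Measure K) : Set (ComplexMeasure K) :=
  {μ | IsRegularMeasure μ ∧ IsConv σ μ μ}

/-- `(σ * f)(x) = ∫ f(y̌ * x) dσ(y)`. -/
def convFun (σ : Measure K) (f : K → ℂ) (x : K) : ℂ := ∫ y, translate f (inv y) x ∂σ

/-- A left-invariant Haar measure: a non-zero Radon measure `ω` with `δ_x * ω = ω`, i.e.
`∫ f(x * y) dω(y) = ∫ f dω` for all `f ∈ C_c(K)`, for every `x`. -/
structure IsLeftHaar (ω : Measure K) : Prop where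
  regular : ω.Regular
  ne_zero : ω ≠ 0
  left_invariant : ∀ (x : K) (f : C_c(K, ℂ)), ∫ y, translate f x y ∂ω = ∫ y, f y ∂ω

/-- `H^1_σ(K)`: the `f ∈ L^1(K) = L^1(K, ω)` with `σ * f = f` (as elements of `L^1`, that is,
`ω`-almost everywhere). -/
def harmonicL1 (ω σ : Measure K) : Set (Lp ℂ 1 ω) :=
  {f | convFun σ f =ᵐ[ω] f}

end

end Hypergroup

/-! Everything rests on a maximum principle (`eq_zero_of_harmonic`). Let `F ∈ C₀(K)` satisfy `∫ F(z
* x) dσ(x) = F(z)` for all `z`. If `F ≠ 0`, then `|F|` attains its maximum `M` at some `z₀`, and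
after a rotation `F(z₀) = M`. An average of values of modulus at most `M` equals `M` only if the
values are `M` on the support. Hence `F(z₀ * y) = M` on `supp σ`, then on its powers by
associativity, then for all `y` by density. The choice `y = ž₀` gives `F(e) = M`, and restarting
from `e` makes `F` constant, which is impossible in `C₀` of a non-compact space.

Both parts produce such an `F` whose value at `e` is the quantity to be killed. For (a), take `f ∈
C_c(K)` and `F(z) = ∫ f(z * y) dμ(y)`; associativity and `σ * μ = μ` make `F` harmonic, and `F(e) =
∫ f dμ`. For (b), take `g ∈ C_c(K)` and `F(z) = ∫ g(y) f(ž * y) dω(y)` (`haarPairing`); averaging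
over `σ` replaces `f` by `σ * f`, and `F(e) = ∫ g f dω`.

The remaining work is measure theory without countability assumptions: `ω` need not be σ-finite, and
sequences do not detect continuity. Fubini is therefore proved by compact cutoffs
(`integral_integral_swap_of_bounded`). In (b), the invariance of `ω`, given only on `C_c(K)`, is
extended to the inequalities `bind_conv_le` and `bind_convMeasure_le` between Borel measures. These
make translation and `f ↦ σ * f` contractive for the `L¹` norm, so identities pass from `C_c(K)` to
`L¹`. -/

set_option linter.unusedSectionVars false

/-! ### Cutoffs and Fubini for finite regular measures -/

section RadonMeasures

open Filter Set
open scoped ENNReal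

variable {X : Type*} [TopologicalSpace X] [T2Space X] [LocallyCompactSpace X]
  [MeasurableSpace X] [BorelSpace X]

/-- A finite regular measure has compactly supported cutoffs which change the integrals of bounded
continuous functions only a little. -/
theorem exists_cutoff_integral_le (m : Measure X) [IsFiniteMeasure m] [m.Regular] {ε : ℝ}
    (hε : 0 < ε) :
    ∃ φ : C(X, ℝ), HasCompactSupport φ ∧ (∀ x, φ x ∈ Icc (0 : ℝ) 1) ∧
      ∀ (h : X → ℂ) (M : ℝ), 0 ≤ M → Continuous h → (∀ x, ‖h x‖ ≤ M) →
        ‖∫ x, h x ∂m - ∫ x, (φ x : ℂ) * h x ∂m‖ ≤ M * ε := by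
  obtain ⟨C, -, hC, hlt⟩ := MeasurableSet.univ.exists_isCompact_sdiff_lt (μ := m)
    (measure_ne_top m univ) (ENNReal.ofReal_pos.2 hε).ne'
  obtain ⟨φ, hφ1, -, hφc, hφ⟩ := exists_continuous_one_zero_of_isCompact hC isClosed_empty
    (disjoint_empty _)
  refine ⟨φ, hφc, hφ, fun h M hM0 hh hM => ?_⟩
  have hbd : ∀ x, ‖(φ x : ℂ) * h x‖ ≤ M := fun x => by
    rw [norm_mul, Complex.norm_real, Real.norm_of_nonneg (hφ x).1]
    exact (mul_le_of_le_one_left (norm_nonneg _) (hφ x).2).trans (hM x)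
  have hi1 : Integrable h m := .of_bound hh.aestronglyMeasurable M (.of_forall hM)
  have hi2 : Integrable (fun x => (φ x : ℂ) * h x) m :=
    .of_bound (by fun_prop) M (.of_forall hbd)
  rw [← integral_sub hi1 hi2]
  have hz : ∀ x ∉ univ \ C, h x - (φ x : ℂ) * h x = 0 := fun x hx => by
    have : φ x = 1 := hφ1 (by simpa using hx)
    simp [this]
  rw [← setIntegral_eq_integral_of_forall_compl_eq_zero hz]
  refine (norm_setIntegral_le_of_norm_le_const (C := M) (hlt.trans ENNReal.ofReal_lt_top)
    fun x _ => ?_).trans ?_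
  · rw [show h x - (φ x : ℂ) * h x = ((1 - φ x : ℝ) : ℂ) * h x by push_cast; ring, norm_mul,
      Complex.norm_real, Real.norm_of_nonneg (sub_nonneg.2 (hφ x).2)]
    exact (mul_le_of_le_one_left (norm_nonneg _) (by linarith [(hφ x).1])).trans (hM x)
  · exact mul_le_mul_of_nonneg_left (ENNReal.toReal_le_of_le_ofReal hε.le hlt.le) hM0

theorem continuous_of_forall_norm_sub_le {Y : Type*} [TopologicalSpace Y] {F : Y → ℂ}
    (h : ∀ ε > 0, ∃ G : Y → ℂ, Continuous G ∧ ∀ y, ‖F y - G y‖ ≤ ε) : Continuous F := by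
  refine continuous_of_uniform_approx_of_continuous fun u hu => ?_
  obtain ⟨ε, hε, hu⟩ := Metric.mem_uniformity_dist.1 hu
  obtain ⟨G, hG, hFG⟩ := h (ε / 2) (half_pos hε)
  exact ⟨G, hG, fun y => hu (by rw [dist_eq_norm]; linarith [hFG y])⟩

theorem continuous_integral_of_hasCompactSupport_mul {Y : Type*} [TopologicalSpace Y]
    (m : Measure X) [IsFiniteMeasureOnCompacts m] {f : Y → X → ℂ}
    (hf : Continuous f.uncurry) {φ : X → ℂ} (hφ : Continuous φ) (hφc : HasCompactSupport φ) :
    Continuous fun y => ∫ x, φ x * f y x ∂m := by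
  rw [← continuousOn_univ]
  refine continuousOn_integral_of_compact_support (f := fun y x => φ x * f y x) hφc
    (Continuous.continuousOn ?_) fun y x _ hx => ?_
  · exact (hφ.comp continuous_snd).mul hf
  · rw [image_eq_zero_of_notMem_tsupport hx, zero_mul]

/-- Since `Y` is an arbitrary space, sequential dominated convergence does not suffice; the integral
is instead a uniform limit of integrals cut off to a compact set. -/
theorem continuous_integral_of_bounded {Y : Type*} [TopologicalSpace Y] (m : Measure X)
    [IsFiniteMeasure m] [m.Regular] {f : Y → X → ℂ} (hf : Continuous f.uncurry) {M : ℝ}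
    (hM : ∀ y x, ‖f y x‖ ≤ M) : Continuous fun y => ∫ x, f y x ∂m := by
  rcases lt_or_ge M 0 with hM0 | hM0
  · have h0 : ∀ y, ∫ x, f y x ∂m = 0 := fun y => by
      rw [show f y = 0 from funext fun x => absurd ((norm_nonneg _).trans (hM y x)) hM0.not_ge]
      simp
    simpa only [h0] using continuous_const
  refine continuous_of_forall_norm_sub_le fun ε hε => ?_
  obtain ⟨φ, hφc, -, h⟩ := exists_cutoff_integral_le m (ε := ε / (M + 1)) (by positivity)
  refine ⟨_, continuous_integral_of_hasCompactSupport_mul m hf (φ := fun x => (φ x : ℂ))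
    (by fun_prop) (hφc.comp_left Complex.ofReal_zero), fun y => ?_⟩
  refine (h (f y) M hM0 (hf.comp (by fun_prop : Continuous fun x => (y, x))) (hM y)).trans ?_
  rw [mul_div_assoc', div_le_iff₀ (by positivity)]
  nlinarith

variable {Y : Type*} [TopologicalSpace Y] [T2Space Y] [LocallyCompactSpace Y]
  [MeasurableSpace Y] [BorelSpace Y]

/-- The estimate behind Fubini's theorem for bounded continuous functions and finite regular
measures: a cutoff in the second variable. -/
theorem integral_integral_swap_of_cutoff (m : Measure X) [IsFiniteMeasure m]
    [m.Regular] (n : Measure Y) [IsFiniteMeasure n] [n.Regular] {f : X → Y → ℂ}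
    (hf : Continuous f.uncurry) {M : ℝ} (hM : ∀ x y, ‖f x y‖ ≤ M)
    (h : ∀ ψ : C(Y, ℝ), HasCompactSupport ψ → (∀ y, ψ y ∈ Icc (0 : ℝ) 1) →
      ∫ x, ∫ y, (ψ y : ℂ) * f x y ∂n ∂m = ∫ y, ∫ x, (ψ y : ℂ) * f x y ∂m ∂n) :
    ∫ x, ∫ y, f x y ∂n ∂m = ∫ y, ∫ x, f x y ∂m ∂n := by
  rcases isEmpty_or_nonempty X with hX | ⟨⟨x₀⟩⟩
  · simp [Measure.eq_zero_of_isEmpty m]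
  rcases isEmpty_or_nonempty Y with hY | ⟨⟨y₀⟩⟩
  · simp [Measure.eq_zero_of_isEmpty n]
  have hM0 : 0 ≤ M := (norm_nonneg _).trans (hM x₀ y₀)
  have hf' : Continuous (Function.uncurry fun y x => f x y) := hf.comp continuous_swap
  have hfx : ∀ x, Continuous (f x) := fun x => hf.comp (by fun_prop : Continuous fun y => (x, y))
  refine eq_of_forall_dist_le fun ε hε => ?_
  set A := m.real univ
  -- Cutting off `ψ` costs at most `M * A * δ` in each iterated integral; the `+ 1` keeps the
  -- denominator positive.
  set δ : ℝ := ε / (2 * (M * A + 1))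
  have hδ : 0 < δ := by positivity
  obtain ⟨ψ, hψc, hψ, hcut⟩ := exists_cutoff_integral_le n hδ
  have hψf : Continuous (Function.uncurry fun x y => (ψ y : ℂ) * f x y) :=
    ((Complex.continuous_ofReal.comp ψ.continuous).comp continuous_snd).mul hf
  have hψM : ∀ x y, ‖(ψ y : ℂ) * f x y‖ ≤ M := fun x y => by
    rw [norm_mul, Complex.norm_real, Real.norm_of_nonneg (hψ y).1]
    exact (mul_le_of_le_one_left (norm_nonneg _) (hψ y).2).trans (hM x y)
  have hbd : ∀ g : X → Y → ℂ, (∀ x y, ‖g x y‖ ≤ M) → ∀ x, ‖∫ y, g x y ∂n‖ ≤ M * n.real univ :=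
    fun g hg x => norm_integral_le_of_norm_le_const (.of_forall (hg x))
  have h1 : ‖∫ x, ∫ y, f x y ∂n ∂m - ∫ x, ∫ y, (ψ y : ℂ) * f x y ∂n ∂m‖ ≤ M * δ * A := by
    rw [← integral_sub
      (.of_bound (continuous_integral_of_bounded n hf hM).aestronglyMeasurable _
        (.of_forall (hbd f hM)))
      (.of_bound (continuous_integral_of_bounded n hψf hψM).aestronglyMeasurable _
        (.of_forall (hbd _ hψM)))]
    exact norm_integral_le_of_norm_le_const (.of_forall fun x => hcut (f x) M hM0 (hfx x) (hM x))
  have h2 : ‖∫ y, ∫ x, f x y ∂m ∂n - ∫ y, ∫ x, (ψ y : ℂ) * f x y ∂m ∂n‖ ≤ M * A * δ := by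
    simp only [integral_const_mul]
    exact hcut _ _ (by positivity) (continuous_integral_of_bounded m hf' fun y x => hM x y)
      fun y => norm_integral_le_of_norm_le_const (.of_forall fun x => hM x y)
  rw [h ψ hψc hψ, norm_sub_rev] at h1
  rw [dist_comm, dist_eq_norm]
  have h3 := (norm_sub_le_norm_sub_add_norm_sub _ _ _).trans (add_le_add h2 h1)
  refine h3.trans ?_
  have : δ * (2 * (M * A + 1)) = ε := div_mul_cancel₀ _ (by positivity)
  nlinarith

/-- Fubini's theorem for bounded continuous functions and finite regular measures, without any
countability assumption. -/
theorem integral_integral_swap_of_bounded (m : Measure X) [IsFiniteMeasure m]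
    [m.Regular] (n : Measure Y) [IsFiniteMeasure n] [n.Regular] {f : X → Y → ℂ}
    (hf : Continuous f.uncurry) {M : ℝ} (hM : ∀ x y, ‖f x y‖ ≤ M) :
    ∫ x, ∫ y, f x y ∂n ∂m = ∫ y, ∫ x, f x y ∂m ∂n := by
  refine integral_integral_swap_of_cutoff m n hf hM fun ψ hψc hψ => ?_
  have hψf : Continuous (Function.uncurry fun x y => (ψ y : ℂ) * f x y) :=
    ((Complex.continuous_ofReal.comp ψ.continuous).comp continuous_snd).mul hf
  have hψM : ∀ x y, ‖(ψ y : ℂ) * f x y‖ ≤ M := fun x y => by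
    rw [norm_mul, Complex.norm_real, Real.norm_of_nonneg (hψ y).1]
    exact (mul_le_of_le_one_left (norm_nonneg _) (hψ y).2).trans (hM x y)
  -- With `y` already cut off by `ψ`, the same estimate with exchanged roles cuts off `x`, which
  -- leaves a compactly supported integrand.
  refine (integral_integral_swap_of_cutoff n m (f := fun y x => (ψ y : ℂ) * f x y)
    (hψf.comp continuous_swap) (fun y x => hψM x y) fun φ hφc hφ => ?_).symm
  refine integral_integral_swap_of_hasCompactSupport
    (f := fun y x => (φ x : ℂ) * ((ψ y : ℂ) * f x y)) ?_ ?_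
  · exact ((Complex.continuous_ofReal.comp φ.continuous).comp continuous_snd).mul
      (hψf.comp continuous_swap)
  · refine HasCompactSupport.intro (hψc.prod hφc) fun p hp => ?_
    rw [mem_prod, not_and_or] at hp
    simp only [Function.uncurry]
    rcases hp with hp | hp <;> simp [image_eq_zero_of_notMem_tsupport hp]

/-- A nonnegative continuous function with vanishing integral vanishes on the support. -/
theorem eq_zero_on_support_of_integral_eq_zero (m : Measure X) {u : X → ℝ} (hu : Continuous u)
    (h0 : ∀ x, 0 ≤ u x) (hi : Integrable u m) (h : ∫ x, u x ∂m = 0) {x : X}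
    (hx : x ∈ m.support) : u x = 0 := by
  by_contra hne
  have hae := (integral_eq_zero_iff_of_nonneg (fun x => h0 x) hi).1 h
  have hU : IsOpen {y | u y ≠ 0} := isOpen_ne_fun hu continuous_const
  have := (Measure.mem_support_iff_forall x).1 hx _ (hU.mem_nhds hne)
  exact this.ne' hae

end RadonMeasures

/-! ### Supports of convolutions and translates -/

namespace Hypergroup

open Filter Set

variable {K : Type*} [TopologicalSpace K] [T2Space K] [LocallyCompactSpace K]
  [MeasurableSpace K] [BorelSpace K] [Hypergroup K]

instance regular_conv (x y : K) : (conv x y : Measure K).Regular := conv_regular x y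

theorem ae_mem_support_conv (x y : K) :
    ∀ᵐ t ∂(conv x y : Measure K), t ∈ (conv x y : Measure K).support :=
  Measure.support_mem_ae_of_regular

theorem eventually_support_conv_subset {x y : K} {U : Set K} (hU : IsOpen U)
    (h : (conv x y : Measure K).support ⊆ U) :
    ∀ᶠ p : K × K in 𝓝 (x, y), (conv p.1 p.2 : Measure K).support ⊆ U :=
  letI := TopologicalSpace.vietoris K
  (hU.powerset_vietoris.preimage continuous_support_conv).mem_nhds h

theorem mem_setMul {A B : Set K} {t : K} :
    t ∈ setMul A B ↔ ∃ x ∈ A, ∃ y ∈ B, t ∈ (conv x y : Measure K).support := by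
  simp [setMul]

/-- Only the upper half of Vietoris continuity is used: a finite subcover of one support still
covers all nearby supports, and compactness of `A ×ˢ B` does the rest. -/
theorem isCompact_setMul {A B : Set K} (hA : IsCompact A) (hB : IsCompact B) :
    IsCompact (setMul A B) := by
  refine isCompact_of_finite_subcover fun {ι} U hU hcov => ?_
  suffices H : ∃ t : Finset ι, ∀ p ∈ A ×ˢ B, (conv p.1 p.2 : Measure K).support ⊆ ⋃ i ∈ t, U i by
    obtain ⟨t, ht⟩ := H
    refine ⟨t, fun s hs => ?_⟩
    obtain ⟨x, hx, y, hy, hs⟩ := mem_setMul.1 hs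
    exact ht (x, y) ⟨hx, hy⟩ hs
  refine (hA.prod hB).induction_on
    (p := fun S => ∃ t : Finset ι, ∀ p ∈ S, (conv p.1 p.2 : Measure K).support ⊆ ⋃ i ∈ t, U i)
    ⟨∅, by simp⟩ (fun S T hST ⟨t, ht⟩ => ⟨t, fun p hp => ht p (hST hp)⟩) ?_ ?_
  · classical
    rintro S T ⟨s, hs⟩ ⟨t, ht⟩
    refine ⟨s ∪ t, fun p hp => ?_⟩
    rw [Finset.set_biUnion_union]
    exact hp.elim (fun h => (hs p h).trans subset_union_left)
      fun h => (ht p h).trans subset_union_right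
  · rintro ⟨x, y⟩ ⟨hx, hy⟩
    obtain ⟨t, ht⟩ := (isCompact_support_conv x y).elim_finite_subcover U hU
      (fun s hs => hcov (mem_setMul.2 ⟨x, hx, y, hy, hs⟩))
    exact ⟨_, mem_nhdsWithin_of_mem_nhds
      (eventually_support_conv_subset (isOpen_biUnion fun i _ => hU i) ht), t, fun p hp => hp⟩

theorem inv_e : inv (e : K) = e := by
  refine ((e_mem_support_conv e e).1 ?_).symm
  rw [e_conv]
  refine (Measure.mem_support_iff_forall _).2 fun U hU => ?_
  simp [Measure.dirac_apply_of_mem (mem_of_mem_nhds hU)]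

theorem inv_mem_support_conv {x y t : K} (h : t ∈ (conv x y : Measure K).support) :
    inv t ∈ (conv (inv y) (inv x) : Measure K).support := by
  rw [← map_inv_conv]
  refine (Measure.mem_support_iff_forall _).2 fun U hU => ?_
  refine ((Measure.mem_support_iff_forall _).1 h _
    (continuous_inv.continuousAt.preimage_mem_nhds hU)).trans_le ?_
  exact Measure.le_map_apply continuous_inv.measurable.aemeasurable _

theorem norm_translate_le {f : K → ℂ} {M : ℝ} (hM : ∀ t, ‖f t‖ ≤ M) (x y : K) :
    ‖translate f x y‖ ≤ M := by
  simpa [translate] using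
    norm_integral_le_of_norm_le_const (μ := (conv x y : Measure K)) (.of_forall hM)

theorem continuous_translate {f : K → ℂ} (hf : Continuous f) {M : ℝ} (hM : ∀ t, ‖f t‖ ≤ M) :
    Continuous fun p : K × K => translate f p.1 p.2 := by
  rw [continuous_iff_continuousAt]
  intro p
  exact (ProbabilityMeasure.tendsto_iff_forall_integral_rclike_tendsto ℂ).1
    (continuous_conv.tendsto p) (BoundedContinuousFunction.ofNormedAddCommGroup f hf M hM)

/-- Associativity, for the translates of a bounded continuous function. -/
theorem translate_translate {f : K → ℂ} (hf : Continuous f) {M : ℝ} (hM : ∀ t, ‖f t‖ ≤ M)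
    (x y z : K) :
    translate (fun t => translate f t z) x y = translate (translate f x) y z :=
  conv_assoc x y z (BoundedContinuousFunction.ofNormedAddCommGroup f hf M hM)

theorem translate_e (f : K → ℂ) (y : K) : translate f e y = f y := by
  rw [translate, e_conv, integral_dirac]

theorem exists_mem_support_of_translate_ne_zero {f : K → ℂ} {x y : K}
    (h : translate f x y ≠ 0) : ∃ t ∈ (conv x y : Measure K).support, f t ≠ 0 := by
  by_contra! hc
  exact h (integral_eq_zero_of_ae ((ae_mem_support_conv x y).mono fun t ht => hc t ht))

theorem integrable_conv {f : K → ℂ} (hf : Continuous f) {M : ℝ} (hM : ∀ t, ‖f t‖ ≤ M) (x y : K) :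
    Integrable f (conv x y : Measure K) :=
  .of_bound hf.aestronglyMeasurable M (.of_forall hM)

/-- This replaces cancellation in a group. Otherwise `e` lies outside `z * (y * x̌)`, and a bump at
`e` has integral zero there. By associativity it also has integral zero over `(z * y) * x̌`, so it
vanishes on `supp(x * x̌)`, which contains `e`. -/
theorem mem_support_conv_inv {x y z : K} (h : x ∈ (conv z y : Measure K).support) :
    z ∈ (conv x (inv y) : Measure K).support := by
  suffices H : inv z ∈ (conv y (inv x) : Measure K).support by
    simpa [inv_inv] using inv_mem_support_conv H
  by_contra hz
  set C := setMul {z} (conv y (inv x) : Measure K).support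
  have hCc : IsCompact C := isCompact_setMul isCompact_singleton (isCompact_support_conv _ _)
  have heC : e ∉ C := fun he => by
    obtain ⟨z', hz', s, hs, he⟩ := mem_setMul.1 he
    rw [mem_singleton_iff.1 hz', e_mem_support_conv] at he
    exact hz (by rwa [he, inv_inv])
  obtain ⟨h', h1, h0, -, h01⟩ := exists_continuous_one_zero_of_isCompact
    (isCompact_singleton (x := (e : K))) hCc.isClosed (disjoint_singleton_left.2 heC)
  set f : K → ℂ := fun t => (h' t : ℂ) with hf
  have hfc : Continuous f := by fun_prop
  have hfM : ∀ t, ‖f t‖ ≤ 1 := fun t => by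
    rw [hf, Complex.norm_real, Real.norm_of_nonneg (h01 t).1]; exact (h01 t).2
  have hR : translate (translate f z) y (inv x) = 0 := by
    by_contra hne
    obtain ⟨s, hs, hs'⟩ := exists_mem_support_of_translate_ne_zero hne
    obtain ⟨t, ht, ht'⟩ := exists_mem_support_of_translate_ne_zero hs'
    refine ht' ?_
    have : h' t = 0 := h0 (mem_setMul.2 ⟨z, rfl, s, hs, ht⟩)
    simp [hf, this]
  rw [← translate_translate hfc hfM] at hR
  set u : K → ℝ := fun t => ∫ s, h' s ∂(conv t (inv x) : Measure K) with hu
  have hfu : ∀ t, translate f t (inv x) = (u t : ℂ) := fun t => integral_ofReal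
  have huc : Continuous u := by
    have := Complex.continuous_re.comp ((continuous_translate hfc hfM).comp
      (by fun_prop : Continuous fun t : K => (t, inv x)))
    exact this.congr fun t => by simp [hfu]
  have hu0 : ∀ t, 0 ≤ u t := fun t => integral_nonneg fun s => (h01 s).1
  have hu1 : ∀ t, ‖u t‖ ≤ 1 := fun t => by
    simpa [hfu] using norm_translate_le hfM t (inv x)
  have hint : ∫ t, u t ∂(conv z y : Measure K) = 0 := by
    have : ((∫ t, u t ∂(conv z y : Measure K) : ℝ) : ℂ) = 0 := by
      rw [← hR, translate]
      simp only [hfu]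
      exact integral_ofReal.symm
    exact_mod_cast this
  have hux := eq_zero_on_support_of_integral_eq_zero _ huc hu0
    (.of_bound huc.aestronglyMeasurable 1 (.of_forall hu1)) hint h
  have hex : e ∈ (conv x (inv x) : Measure K).support :=
    (e_mem_support_conv _ _).2 (inv_inv x).symm
  have := eq_zero_on_support_of_integral_eq_zero _ h'.continuous (fun t => (h01 t).1)
    (.of_bound h'.continuous.aestronglyMeasurable 1 (.of_forall fun t => by
      rw [Real.norm_of_nonneg (h01 t).1]; exact (h01 t).2)) hux hex
  rw [h1 rfl] at this
  exact one_ne_zero this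

theorem mem_support_inv_conv {x y z : K} (h : x ∈ (conv z y : Measure K).support) :
    y ∈ (conv (inv z) x : Measure K).support := by
  simpa [inv_inv] using inv_mem_support_conv (mem_support_conv_inv (inv_mem_support_conv h))

/-- Left translates of compactly supported functions are compactly supported. -/
theorem hasCompactSupport_translate {f : K → ℂ} (hfc : HasCompactSupport f) (z : K) :
    HasCompactSupport (translate f z) := by
  refine HasCompactSupport.intro
    (isCompact_setMul (isCompact_singleton (x := inv z)) hfc.isCompact) fun y hy => ?_
  by_contra hne
  obtain ⟨t, ht, hft⟩ := exists_mem_support_of_translate_ne_zero hne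
  exact hy (mem_setMul.2 ⟨_, rfl, t, subset_tsupport _ hft, mem_support_inv_conv ht⟩)

/-- If `x * y` meets the support of `f` with `y` in `C`, then `x` is in the compact set
`supp f * Č`. -/
theorem mem_of_translate_ne_zero {f : K → ℂ} {C : Set K} {x y : K} (hy : y ∈ C)
    (h : translate f x y ≠ 0) : x ∈ setMul (tsupport f) (inv '' C) := by
  obtain ⟨t, ht, hft⟩ := exists_mem_support_of_translate_ne_zero h
  exact mem_setMul.2 ⟨t, subset_tsupport _ hft, _, mem_image_of_mem _ hy, mem_support_conv_inv ht⟩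

end Hypergroup

/-! ### The maximum principle -/

namespace Hypergroup

open Filter Set

/-- A continuous function bounded by `M` whose mean is `M` equals `M` on the support. -/
theorem eq_on_support_of_integral_eq {X : Type*} [TopologicalSpace X]
    [T2Space X] [LocallyCompactSpace X] [MeasurableSpace X] [BorelSpace X] (m : Measure X)
    [IsProbabilityMeasure m] {f : X → ℂ} (hf : Continuous f) {M : ℝ} (hM : ∀ x, ‖f x‖ ≤ M)
    (h : ∫ x, f x ∂m = M) {x : X} (hx : x ∈ m.support) : f x = M := by
  have hfi : Integrable f m := .of_bound hf.aestronglyMeasurable M (.of_forall hM)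
  have hre : (f x).re = M := by
    have h0 : ∫ x, (M - (f x).re) ∂m = 0 := by
      have h1 : ∫ x, (f x).re ∂m = (∫ x, f x ∂m).re := integral_re hfi
      rw [integral_sub (g := fun x => (f x).re) (integrable_const M) hfi.re, h1, h]
      simp
    have := eq_zero_on_support_of_integral_eq_zero m (u := fun x => M - (f x).re) (by fun_prop)
      (fun y => sub_nonneg.2 ((Complex.re_le_norm _).trans (hM y)))
      ((integrable_const M).sub hfi.re) h0 hx
    linarith
  have hsq : (f x).re * (f x).re + (f x).im * (f x).im ≤ M * M := by
    rw [← Complex.normSq_apply, Complex.normSq_eq_norm_sq, sq]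
    exact mul_self_le_mul_self (norm_nonneg _) (hM x)
  rw [hre] at hsq
  exact Complex.ext hre (by simpa using mul_self_eq_zero.1 (le_antisymm (by linarith)
    (mul_self_nonneg (f x).im)))

variable {K : Type*} [TopologicalSpace K] [T2Space K] [LocallyCompactSpace K]
  [MeasurableSpace K] [BorelSpace K] [Hypergroup K]

theorem translate_eq_of_forall_mem_support {f : K → ℂ} {c : ℂ} {x y : K}
    (h : ∀ t ∈ (conv x y : Measure K).support, f t = c) : translate f x y = c := by
  rw [translate, integral_congr_ae ((ae_mem_support_conv x y).mono h)]
  simp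

/-- A bounded continuous function which is harmonic for a non-degenerate `σ` and attains its
maximal modulus is constant. -/
theorem eq_const_of_harmonic (σ : Measure K) [IsProbabilityMeasure σ] (hσ : IsNondegenerate σ)
    {f : K → ℂ} (hf : Continuous f) {M : ℝ} (hM : ∀ x, ‖f x‖ ≤ M)
    (hharm : ∀ z, ∫ x, translate f z x ∂σ = f z) {z₀ : K} (hz₀ : f z₀ = M) (x : K) : f x = M := by
  have hcont (z : K) : Continuous (translate f z) :=
    (continuous_translate hf hM).comp (by fun_prop : Continuous fun y : K => (z, y))
  -- The base point `z` is quantified inside the set of good `y`: the inductive step moves from `z`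
  -- to every point of `supp(z * w)`.
  have hP : ∀ y z, f z = M → translate f z y = M := by
    suffices H : univ ⊆ {y : K | ∀ z, f z = M → translate f z y = M} from fun y => H (mem_univ y)
    rw [← show closure _ = univ from hσ]
    refine closure_minimal (iUnion_subset fun n => ?_) ?_
    · have hS : ∀ y ∈ σ.support, ∀ z, f z = M → translate f z y = M := fun y hy z hz =>
        eq_on_support_of_integral_eq σ (hcont z) (norm_translate_le hM z) ((hharm z).trans hz) hy
      induction n with
      | zero => exact hS
      | succ n ih =>
        intro r hr z hz
        obtain ⟨w, hw, s, hs, hr⟩ := mem_setMul.1 hr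
        refine eq_on_support_of_integral_eq _ (hcont z) (norm_translate_le hM z) ?_ hr
        change translate (translate f z) w s = M
        rw [← translate_translate hf hM]
        refine translate_eq_of_forall_mem_support fun t ht => hS s hs t ?_
        exact eq_on_support_of_integral_eq _ hf hM (ih hw z hz) ht
    · simp only [ofPred_forall]
      exact isClosed_iInter fun z => isClosed_iInter fun _ =>
        isClosed_eq (hcont z) continuous_const
  -- The maximum is carried to the identity because `e ∈ supp(z₀ * ž₀)`.
  have he : f e = M := eq_on_support_of_integral_eq _ hf hM (hP (inv z₀) z₀ hz₀)
    ((e_mem_support_conv _ _).2 (inv_inv _).symm)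
  rw [← hP x e he, translate_e]

/-- Maximum principle: on a non-compact hypergroup there is no non-zero harmonic function
vanishing at infinity. -/
theorem eq_zero_of_harmonic [NoncompactSpace K] (σ : Measure K) [IsProbabilityMeasure σ]
    (hσ : IsNondegenerate σ) (F : C₀(K, ℂ)) (hharm : ∀ z, ∫ x, translate F z x ∂σ = F z) :
    F = 0 := by
  by_contra hne
  obtain ⟨w, hw⟩ : ∃ w, F w ≠ 0 := by
    by_contra! h
    exact hne (ZeroAtInftyContinuousMap.ext h)
  have hlim : Tendsto (fun x => ‖F x‖) (cocompact K) (𝓝 0) := by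
    simpa using (zero_at_infty F).norm
  obtain ⟨z₀, hz₀⟩ := F.continuous.norm.exists_forall_ge' w
    ((hlim.eventually_lt_const (norm_pos_iff.2 hw)).mono fun x hx => hx.le)
  have hpos : 0 < ‖F z₀‖ := (norm_pos_iff.2 hw).trans_le (hz₀ w)
  -- A unimodular factor that makes the value at `z₀` equal to its modulus.
  set c : ℂ := ‖F z₀‖ / F z₀ with hc
  have hF0 : F z₀ ≠ 0 := norm_pos_iff.1 hpos
  have hcn : ‖c‖ = 1 := by
    rw [hc, norm_div, Complex.norm_real, norm_norm, div_self hpos.ne']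
  have hconst := eq_const_of_harmonic σ hσ (f := fun x => c * F x) (M := ‖F z₀‖)
    (continuous_const.mul F.continuous)
    (fun x => by rw [norm_mul, hcn, one_mul]; exact hz₀ x)
    (fun z => by
      rw [← hharm z, ← integral_const_mul]
      exact integral_congr_ae (.of_forall fun x => integral_const_mul _ _))
    (z₀ := z₀) (div_mul_cancel₀ _ hF0)
  obtain ⟨x, hx⟩ := (hlim.eventually_lt_const hpos).exists
  refine hx.ne ?_
  have := congrArg norm (hconst x)
  simpa [hcn] using this

/-- A uniform limit of continuous compactly supported functions vanishes at infinity. -/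
theorem exists_zeroAtInfty_of_forall_norm_sub_le {X : Type*} [TopologicalSpace X] {F : X → ℂ}
    (h : ∀ ε > 0, ∃ G : X → ℂ, Continuous G ∧ HasCompactSupport G ∧ ∀ x, ‖F x - G x‖ ≤ ε) :
    ∃ F' : C₀(X, ℂ), ⇑F' = F := by
  have hc : Continuous F := continuous_of_forall_norm_sub_le fun ε hε =>
    let ⟨G, h1, _, h3⟩ := h ε hε; ⟨G, h1, h3⟩
  refine ⟨⟨⟨F, hc⟩, ?_⟩, rfl⟩
  rw [Metric.tendsto_nhds]
  intro ε hε
  obtain ⟨G, -, hGc, hFG⟩ := h (ε / 2) (half_pos hε)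
  filter_upwards [hGc.isCompact.compl_mem_cocompact] with x hx
  have := hFG x
  rw [image_eq_zero_of_notMem_tsupport hx, sub_zero] at this
  simpa using this.trans_lt (half_lt_self hε)

end Hypergroup

/-! ### Complex measures through Jordan decompositions -/

section ComplexMeasures

open Filter Set
open scoped ENNReal

variable {X : Type*} [MeasurableSpace X]

theorem MeasureTheory.ComplexMeasure.variation_re_le (μ : ComplexMeasure X) :
    (ComplexMeasure.re μ).variation ≤ μ.variation :=
  VectorMeasure.variation_le_of_forall_enorm_le fun E _ =>
    le_trans (enorm_le_iff_norm_le.2 (Complex.abs_re_le_norm (μ E)))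
      (VectorMeasure.enorm_measure_le_variation μ E)

theorem MeasureTheory.ComplexMeasure.variation_im_le (μ : ComplexMeasure X) :
    (ComplexMeasure.im μ).variation ≤ μ.variation :=
  VectorMeasure.variation_le_of_forall_enorm_le fun E _ =>
    le_trans (enorm_le_iff_norm_le.2 (Complex.abs_im_le_norm (μ E)))
      (VectorMeasure.enorm_measure_le_variation μ E)

theorem MeasureTheory.ComplexMeasure.variation_le_add (μ : ComplexMeasure X) :
    μ.variation ≤ (ComplexMeasure.re μ).variation + (ComplexMeasure.im μ).variation := by
  refine VectorMeasure.variation_le_of_forall_enorm_le fun E _ => ?_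
  have h : ‖μ E‖ₑ ≤ ‖(μ E).re‖ₑ + ‖(μ E).im‖ₑ := by
    rw [← Complex.re_add_im (μ E)]
    refine (enorm_add_le _ _).trans (le_of_eq ?_)
    simp [← ofReal_norm]
  exact h.trans (add_le_add (VectorMeasure.enorm_measure_le_variation (ComplexMeasure.re μ) E)
    (VectorMeasure.enorm_measure_le_variation (ComplexMeasure.im μ) E))

instance MeasureTheory.SignedMeasure.isFiniteMeasure_variation (s : SignedMeasure X) :
    IsFiniteMeasure s.variation := by
  rw [← SignedMeasure.totalVariation_eq_variation, SignedMeasure.totalVariation]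
  infer_instance

instance MeasureTheory.ComplexMeasure.isFiniteMeasure_variation (μ : ComplexMeasure X) :
    IsFiniteMeasure μ.variation :=
  isFiniteMeasure_of_le _ μ.variation_le_add

theorem MeasureTheory.SignedMeasure.posPart_le_variation (s : SignedMeasure X) :
    s.toJordanDecomposition.posPart ≤ s.variation := by
  rw [← SignedMeasure.totalVariation_eq_variation, SignedMeasure.totalVariation]
  exact Measure.le_add_right le_rfl

theorem MeasureTheory.SignedMeasure.negPart_le_variation (s : SignedMeasure X) :
    s.toJordanDecomposition.negPart ≤ s.variation := by
  rw [← SignedMeasure.totalVariation_eq_variation, SignedMeasure.totalVariation]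
  exact Measure.le_add_left le_rfl

/-- The map is 1-Lipschitz. It serves the four Jordan parts, all dominated by the total variation.
-/
theorem MeasureTheory.continuous_integral_Lp_of_le {m p : Measure X} (h : p ≤ m) :
    Continuous fun f : Lp ℂ 1 m => ∫ x, f x ∂p := by
  refine LipschitzWith.continuous (K := 1) (LipschitzWith.of_dist_le_mul fun f g => ?_)
  have hf := L1.integrable_coeFn f
  have hg := L1.integrable_coeFn g
  rw [dist_eq_norm, ← integral_sub (hf.mono_measure h) (hg.mono_measure h), NNReal.coe_one, one_mul,
    dist_eq_norm, L1.norm_eq_integral_norm]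
  refine (norm_integral_le_integral_norm _).trans ?_
  refine (integral_mono_measure h (.of_forall fun x => norm_nonneg _) (hf.sub hg).norm).trans ?_
  refine le_of_eq (integral_congr_ae ?_)
  filter_upwards [Lp.coeFn_sub f g] with x hx
  rw [hx, Pi.sub_apply]

/-- The integral against a complex measure, in terms of the Jordan decompositions of its real and
imaginary part. -/
theorem Hypergroup.cintegral_eq_jordan {X : Type*} [TopologicalSpace X] [T2Space X]
    [LocallyCompactSpace X] [MeasurableSpace X] [BorelSpace X] (μ : ComplexMeasure X) {f : X → ℂ}
    (hf : Integrable f μ.variation) :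
    Hypergroup.cintegral μ f =
      (∫ x, f x ∂(ComplexMeasure.re μ).toJordanDecomposition.posPart -
        ∫ x, f x ∂(ComplexMeasure.re μ).toJordanDecomposition.negPart) +
      Complex.I * (∫ x, f x ∂(ComplexMeasure.im μ).toJordanDecomposition.posPart -
        ∫ x, f x ∂(ComplexMeasure.im μ).toJordanDecomposition.negPart) := by
  have h1 := (ComplexMeasure.re μ).posPart_le_variation.trans μ.variation_re_le
  have h2 := (ComplexMeasure.re μ).negPart_le_variation.trans μ.variation_re_le
  have h3 := (ComplexMeasure.im μ).posPart_le_variation.trans μ.variation_im_le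
  have h4 := (ComplexMeasure.im μ).negPart_le_variation.trans μ.variation_im_le
  have hreal (p : Measure X) (c : ℂ) {s : Set X} (hs : MeasurableSet s) :
      ∫ x, s.indicator (fun _ => c) x ∂p = p.real s * c := by
    rw [integral_indicator_const _ hs, Complex.real_smul]
  -- Both sides are additive and continuous on `L¹(|μ|)`, so indicators of measurable sets suffice.
  refine Integrable.induction (μ := μ.variation) (fun f => Hypergroup.cintegral μ f =
      (∫ x, f x ∂(ComplexMeasure.re μ).toJordanDecomposition.posPart -
        ∫ x, f x ∂(ComplexMeasure.re μ).toJordanDecomposition.negPart) +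
      Complex.I * (∫ x, f x ∂(ComplexMeasure.im μ).toJordanDecomposition.posPart -
        ∫ x, f x ∂(ComplexMeasure.im μ).toJordanDecomposition.negPart))
    (fun c s hs _ => ?_) (fun f g _ hf hg hPf hPg => ?_) ?_ (fun f g hfg _ hPf => ?_) hf
  · have hre := (ComplexMeasure.re μ).apply_eq_posPart_real_sub_negPart_real hs
    have him := (ComplexMeasure.im μ).apply_eq_posPart_real_sub_negPart_real hs
    have hL : Hypergroup.cintegral μ (s.indicator fun _ => c) = c * μ s :=
      VectorMeasure.integral_indicator_const c hs
    have hμ : μ s = ((ComplexMeasure.re μ s : ℝ) : ℂ) + (ComplexMeasure.im μ s : ℝ) * Complex.I :=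
      (Complex.re_add_im (μ s)).symm
    rw [hL, hreal _ _ hs, hreal _ _ hs, hreal _ _ hs, hreal _ _ hs, hμ, hre, him]
    push_cast
    ring
  · have hadd : Hypergroup.cintegral μ (f + g) =
        Hypergroup.cintegral μ f + Hypergroup.cintegral μ g :=
      VectorMeasure.integral_add hf hg
    rw [hadd, hPf, hPg]
    simp only [Pi.add_apply]
    rw [integral_add (hf.mono_measure h1) (hg.mono_measure h1),
      integral_add (hf.mono_measure h2) (hg.mono_measure h2),
      integral_add (hf.mono_measure h3) (hg.mono_measure h3),
      integral_add (hf.mono_measure h4) (hg.mono_measure h4)]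
    ring
  · exact isClosed_eq VectorMeasure.continuous_integral
      (((continuous_integral_Lp_of_le h1).sub (continuous_integral_Lp_of_le h2)).add
        (continuous_const.mul
          ((continuous_integral_Lp_of_le h3).sub (continuous_integral_Lp_of_le h4))))
  · rw [show Hypergroup.cintegral μ g = Hypergroup.cintegral μ f from
        (VectorMeasure.integral_congr_ae hfg).symm, hPf,
      integral_congr_ae (Measure.absolutelyContinuous_of_le h1 hfg),
      integral_congr_ae (Measure.absolutelyContinuous_of_le h2 hfg),
      integral_congr_ae (Measure.absolutelyContinuous_of_le h3 hfg),
      integral_congr_ae (Measure.absolutelyContinuous_of_le h4 hfg)]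

/-- A compact subset of `A` that misses little `m`-mass misses even less `p`-mass; for finite
measures this inner regularity yields full regularity. -/
theorem MeasureTheory.Measure.Regular.of_le {X : Type*} [TopologicalSpace X] [T2Space X]
    [MeasurableSpace X] [BorelSpace X] {m p : Measure X} [IsFiniteMeasure m] [m.Regular]
    (h : p ≤ m) : p.Regular := by
  have : IsFiniteMeasure p := isFiniteMeasure_of_le m h
  have : p.InnerRegularCompactLTTop := by
    refine ⟨fun A hA r hr => ?_⟩
    obtain ⟨C, hCA, hC, hlt⟩ := hA.1.exists_isCompact_sdiff_lt (μ := m) (measure_ne_top m A)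
      (tsub_pos_of_lt hr).ne'
    refine ⟨C, hCA, hC, lt_of_not_ge fun hCr => ?_⟩
    have h1 : p A ≤ p C + p (A \ C) := by
      rw [measure_add_sdiff hC.measurableSet.nullMeasurableSet]
      exact measure_mono subset_union_right
    have h2 : p A < r + (p A - r) :=
      h1.trans_lt (ENNReal.add_lt_add_of_le_of_lt (measure_ne_top p C) hCr ((h _).trans_lt hlt))
    rw [add_tsub_cancel_of_le hr.le] at h2
    exact h2.false
  infer_instance

/-- A regular complex measure is determined by the integrals of compactly supported functions. -/
theorem Hypergroup.eq_zero_of_forall_cintegral_eq_zero {X : Type*} [TopologicalSpace X] [T2Space X]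
    [LocallyCompactSpace X] [MeasurableSpace X] [BorelSpace X] {μ : ComplexMeasure X}
    (hμ : μ.variation.Regular)
    (h : ∀ f : X → ℂ, Continuous f → HasCompactSupport f → Hypergroup.cintegral μ f = 0) :
    μ = 0 := by
  have h1 := (ComplexMeasure.re μ).posPart_le_variation.trans μ.variation_re_le
  have h2 := (ComplexMeasure.re μ).negPart_le_variation.trans μ.variation_re_le
  have h3 := (ComplexMeasure.im μ).posPart_le_variation.trans μ.variation_im_le
  have h4 := (ComplexMeasure.im μ).negPart_le_variation.trans μ.variation_im_le
  have r1 := Measure.Regular.of_le h1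
  have r2 := Measure.Regular.of_le h2
  have r3 := Measure.Regular.of_le h3
  have r4 := Measure.Regular.of_le h4
  -- With real test functions, the real and imaginary parts of the identity separate, and each
  -- equates a positive with a negative Jordan part.
  have key : ∀ f : C_c(X, ℝ), _ := fun f =>
    (Hypergroup.cintegral_eq_jordan μ (f := fun x => (f x : ℂ))
      (Integrable.ofReal f.integrable)).symm.trans
      (h _ (by fun_prop) (f.hasCompactSupport.comp_left Complex.ofReal_zero))
  simp only [integral_complex_ofReal, ← Complex.ofReal_sub] at key
  have hre : ComplexMeasure.re μ = 0 := by
    rw [← SignedMeasure.toSignedMeasure_toJordanDecomposition (ComplexMeasure.re μ),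
      JordanDecomposition.toSignedMeasure, sub_eq_zero]
    congr 1
    refine Measure.ext_of_integral_eq_on_compactlySupported fun f => ?_
    have := congrArg Complex.re (key f)
    simp [-ComplexMeasure.re_apply, -ComplexMeasure.im_apply] at this
    linarith
  have him : ComplexMeasure.im μ = 0 := by
    rw [← SignedMeasure.toSignedMeasure_toJordanDecomposition (ComplexMeasure.im μ),
      JordanDecomposition.toSignedMeasure, sub_eq_zero]
    congr 1
    refine Measure.ext_of_integral_eq_on_compactlySupported fun f => ?_
    have := congrArg Complex.im (key f)
    simp [-ComplexMeasure.re_apply, -ComplexMeasure.im_apply] at this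
    linarith
  rw [← ComplexMeasure.toComplexMeasure_to_signedMeasure μ, hre, him]
  ext s _
  rfl

/-- The integral against a regular complex measure is a combination of integrals against finite
regular measures. -/
theorem Hypergroup.exists_cintegral_eq_sum {X : Type*} [TopologicalSpace X] [T2Space X]
    [LocallyCompactSpace X] [MeasurableSpace X] [BorelSpace X] {μ : ComplexMeasure X}
    (hμ : μ.variation.Regular) :
    ∃ (c : Fin 4 → ℂ) (m : Fin 4 → Measure X), (∀ i, IsFiniteMeasure (m i)) ∧
      (∀ i, (m i).Regular) ∧ ∀ (f : X → ℂ) (M : ℝ), Continuous f → (∀ x, ‖f x‖ ≤ M) →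
        Hypergroup.cintegral μ f = ∑ i, c i * ∫ x, f x ∂(m i) := by
  have h1 := (ComplexMeasure.re μ).posPart_le_variation.trans μ.variation_re_le
  have h2 := (ComplexMeasure.re μ).negPart_le_variation.trans μ.variation_re_le
  have h3 := (ComplexMeasure.im μ).posPart_le_variation.trans μ.variation_im_le
  have h4 := (ComplexMeasure.im μ).negPart_le_variation.trans μ.variation_im_le
  set m : Fin 4 → Measure X := ![(ComplexMeasure.re μ).toJordanDecomposition.posPart,
    (ComplexMeasure.re μ).toJordanDecomposition.negPart,
    (ComplexMeasure.im μ).toJordanDecomposition.posPart,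
    (ComplexMeasure.im μ).toJordanDecomposition.negPart] with hm
  have hle : ∀ i, m i ≤ μ.variation := by
    intro i
    fin_cases i
    exacts [h1, h2, h3, h4]
  refine ⟨![1, -1, Complex.I, -Complex.I], m, fun i => isFiniteMeasure_of_le _ (hle i),
    fun i => Measure.Regular.of_le (hle i), fun f M hf hM => ?_⟩
  rw [Hypergroup.cintegral_eq_jordan μ
    (.of_bound hf.aestronglyMeasurable M (.of_forall hM)), Fin.sum_univ_four]
  simp [hm]
  ring

end ComplexMeasures

/-! ### Part (a): harmonic measures -/

namespace Hypergroup

open Filter Set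

variable {K : Type*} [TopologicalSpace K] [T2Space K] [LocallyCompactSpace K]
  [MeasurableSpace K] [BorelSpace K] [Hypergroup K]

/-- `z ↦ ∫ f(z * y) dm(y)` vanishes at infinity for a finite regular measure `m`. -/
theorem exists_zeroAtInfty_integral_translate (m : Measure K) [IsFiniteMeasure m] [m.Regular]
    {f : K → ℂ} (hf : Continuous f) (hfc : HasCompactSupport f) :
    ∃ F : C₀(K, ℂ), ⇑F = fun z => ∫ y, translate f z y ∂m := by
  obtain ⟨M, hM⟩ := hf.bounded_above_of_compact_support hfc
  have hM0 : 0 ≤ M := (norm_nonneg _).trans (hM e)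
  have hT : Continuous (Function.uncurry fun z y => translate f z y) := continuous_translate hf hM
  refine exists_zeroAtInfty_of_forall_norm_sub_le fun ε hε => ?_
  obtain ⟨φ, hφc, -, hφ⟩ := exists_cutoff_integral_le m (ε := ε / (M + 1)) (by positivity)
  refine ⟨fun z => ∫ y, (φ y : ℂ) * translate f z y ∂m,
    continuous_integral_of_hasCompactSupport_mul m hT (φ := fun x => (φ x : ℂ))
    (by fun_prop) (hφc.comp_left Complex.ofReal_zero), ?_, fun z => ?_⟩
  · refine HasCompactSupport.intro
      (isCompact_setMul hfc.isCompact (hφc.isCompact.image continuous_inv)) fun z hz => ?_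
    refine integral_eq_zero_of_ae (.of_forall fun y => ?_)
    by_contra hne
    obtain ⟨h1, h2⟩ := mul_ne_zero_iff.1 hne
    exact hz (mem_of_translate_ne_zero (subset_tsupport _ fun h => h1 (by simp [h])) h2)
  · refine (hφ _ M hM0 (hT.comp (by fun_prop : Continuous fun y : K => (z, y)))
      (norm_translate_le hM z)).trans ?_
    rw [mul_div_assoc', div_le_iff₀ (by positivity)]
    nlinarith

theorem translate_integral_translate (m : Measure K) [IsFiniteMeasure m] [m.Regular]
    {f : K → ℂ} (hf : Continuous f) {M : ℝ} (hM : ∀ t, ‖f t‖ ≤ M) (z x : K) :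
    translate (fun t => ∫ y, translate f t y ∂m) z x =
      ∫ y, translate (translate f z) x y ∂m := by
  rw [translate, integral_integral_swap_of_bounded (f := fun t y => translate f t y) _ m
    (continuous_translate hf hM) (norm_translate_le hM)]
  exact integral_congr_ae (.of_forall fun y => translate_translate hf hM z x y)

/-- For `F(t) = ∫ f(t * y) dm(y)`, the `σ`-average of `F(z * x)` becomes the pairing of `m` with
exactly the expression that defines `σ * m` on the test function `translate f z`. -/
theorem integral_translate_integral_translate (σ m : Measure K) [IsFiniteMeasure σ] [σ.Regular]
    [IsFiniteMeasure m] [m.Regular] {f : K → ℂ} (hf : Continuous f) {M : ℝ}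
    (hM : ∀ t, ‖f t‖ ≤ M) (z : K) :
    ∫ x, translate (fun t => ∫ y, translate f t y ∂m) z x ∂σ =
      ∫ y, ∫ x, translate (translate f z) x y ∂σ ∂m := by
  simp only [translate_integral_translate m hf hM]
  exact integral_integral_swap_of_bounded _ _ (f := translate (translate f z))
    (continuous_translate ((continuous_translate hf hM).comp
      (by fun_prop : Continuous fun y : K => (z, y))) (norm_translate_le hM z))
    (norm_translate_le (norm_translate_le hM z))

theorem harmonicMeasures_eq_zero [NoncompactSpace K] (σ : Measure K) [IsProbabilityMeasure σ]
    [σ.Regular] (hσ : IsNondegenerate σ) : harmonicMeasures σ = {0} := by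
  refine Subset.antisymm (fun μ hμ => ?_) (singleton_subset_iff.2 ?_)
  · obtain ⟨hreg, -, hconv⟩ := hμ
    refine eq_zero_of_forall_cintegral_eq_zero hreg fun f hf hfc => ?_
    obtain ⟨M, hM⟩ := hf.bounded_above_of_compact_support hfc
    obtain ⟨c, m, hfin, hmreg, hdec⟩ := exists_cintegral_eq_sum hreg
    have hTz : ∀ z, Continuous (translate f z) := fun z =>
      (continuous_translate hf hM).comp (by fun_prop : Continuous fun y : K => (z, y))
    choose F hF using fun i => exists_zeroAtInfty_integral_translate (m i) hf hfc
    -- This is `z ↦ ∫ f(z * y) dμ(y)`, assembled from four positive measures because Fubini is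
    -- available for those.
    set G : C₀(K, ℂ) := ∑ i, c i • F i with hG
    have hGF : ⇑G = fun z => ∑ i, c i * F i z := by
      ext z
      simp [hG, Fin.sum_univ_four]
    have hGz : ∀ z, G z = cintegral μ (translate f z) := fun z => by
      rw [hdec _ M (hTz z) (norm_translate_le hM z), hGF]
      simp only [hF]
    have hFb : ∀ i, ∃ B, ∀ x, ‖F i x‖ ≤ B := fun i =>
      ⟨‖(F i).toBCF‖, fun x => (F i).toBCF.norm_coe_le_norm x⟩
    choose B hB using hFb
    have hzero := eq_zero_of_harmonic σ hσ G fun z => by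
      have hTG : ∀ x, translate G z x = ∑ i, c i * translate (F i) z x := fun x => by
        rw [hGF, translate, integral_finsetSum _ fun i _ =>
          (integrable_conv (map_continuous (F i)) (hB i) z x).const_mul _]
        simp only [integral_const_mul]
        rfl
      have hint : ∀ i, Integrable (translate (F i) z) σ := fun i =>
        .of_bound ((continuous_translate (map_continuous (F i)) (hB i)).comp
          (by fun_prop : Continuous fun y : K => (z, y))).aestronglyMeasurable (B i)
          (.of_forall (norm_translate_le (hB i) z))
      simp only [hTG]
      rw [integral_finsetSum _ fun i _ => (hint i).const_mul _]
      simp only [integral_const_mul, hF,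
        integral_translate_integral_translate σ (m _) hf hM]
      have hcont : Continuous fun y => ∫ x, translate (translate f z) x y ∂σ :=
        continuous_integral_of_bounded σ (f := fun y x => translate (translate f z) x y)
          ((continuous_translate (hTz z) (norm_translate_le hM z)).comp continuous_swap)
          fun y x => norm_translate_le (norm_translate_le hM z) x y
      rw [← hdec _ (M * σ.real univ) hcont fun y => norm_integral_le_of_norm_le_const
        (.of_forall fun x => norm_translate_le (norm_translate_le hM z) x y), hGz]
      -- The relation `σ * μ = μ` is tested on `C₀` only; `translate f z` qualifies, being
      -- continuous with compact support.
      obtain ⟨g, hg⟩ := exists_zeroAtInfty_of_forall_norm_sub_le (F := translate f z)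
        fun ε hε => ⟨_, hTz z, hasCompactSupport_translate hfc z, fun x => by simpa using hε.le⟩
      have := hconv g
      rw [hg] at this
      exact this.symm
    have h0 := hGz e
    rw [hzero, show translate f e = f from funext (translate_e f)] at h0
    exact h0.symm
  · have hreg : IsRegularMeasure (0 : ComplexMeasure K) := by
      rw [IsRegularMeasure, VectorMeasure.variation_zero]
      infer_instance
    refine ⟨hreg, hreg, fun f => ?_⟩
    simp [cintegral, VectorMeasure.integral_zero_vectorMeasure]

end Hypergroup

/-! ### Mixtures of Radon measures without σ-finiteness -/

section RadonKernels

open Filter Set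
open scoped ENNReal NNReal

/-- `h` is continuous, compactly supported, with values in `[0, 1]`, and vanishes outside `U`. -/
structure IsTestBelow {X : Type*} [TopologicalSpace X] (U : Set X) (h : X → ℝ≥0) : Prop where
  continuous : Continuous h
  hasCompactSupport : HasCompactSupport h
  le_one : ∀ x, h x ≤ 1
  eq_zero : ∀ x ∉ U, h x = 0

namespace IsTestBelow

variable {X : Type*} [TopologicalSpace X] [T2Space X] {U : Set X} {g h : X → ℝ≥0}

theorem zero (U : Set X) : IsTestBelow U (0 : X → ℝ≥0) :=
  ⟨continuous_const, HasCompactSupport.zero, fun _ => zero_le_one, fun _ _ => rfl⟩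

theorem sup (hg : IsTestBelow U g) (hh : IsTestBelow U h) : IsTestBelow U (g ⊔ h) where
  continuous := hg.continuous.sup hh.continuous
  hasCompactSupport := by
    refine HasCompactSupport.intro (hg.hasCompactSupport.isCompact.union
      hh.hasCompactSupport.isCompact) fun x hx => ?_
    rw [mem_union, not_or] at hx
    simp [image_eq_zero_of_notMem_tsupport hx.1, image_eq_zero_of_notMem_tsupport hx.2]
  le_one x := sup_le (hg.le_one x) (hh.le_one x)
  eq_zero x hx := by simp [hg.eq_zero x hx, hh.eq_zero x hx]

theorem mono {V : Set X} (hh : IsTestBelow U h) (hUV : U ⊆ V) : IsTestBelow V h :=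
  ⟨hh.1, hh.2, hh.3, fun x hx => hh.4 x fun h => hx (hUV h)⟩

theorem lintegral_le [MeasurableSpace X] [BorelSpace X] (hh : IsTestBelow U h) (hU : IsOpen U)
    (μ : Measure X) : ∫⁻ x, h x ∂μ ≤ μ U := by
  rw [← lintegral_indicator_one hU.measurableSet]
  refine lintegral_mono fun x => ?_
  by_cases hx : x ∈ U
  · simpa [hx] using hh.le_one x
  · simp [hh.eq_zero x hx]

end IsTestBelow

theorem exists_isTestBelow {X : Type*} [TopologicalSpace X] [T2Space X] [LocallyCompactSpace X]
    {C U : Set X} (hC : IsCompact C) (hU : IsOpen U) (hCU : C ⊆ U) :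
    ∃ h : X → ℝ≥0, IsTestBelow U h ∧ ∀ x ∈ C, h x = 1 := by
  obtain ⟨φ, hφ1, hφ0, hφc, hφ⟩ := exists_continuous_one_zero_of_isCompact hC hU.isClosed_compl
    (disjoint_compl_right_iff_subset.2 hCU)
  refine ⟨fun x => (φ x).toNNReal, ⟨by fun_prop, hφc.comp_left Real.toNNReal_zero, fun x => ?_,
    fun x hx => ?_⟩, fun x hx => ?_⟩
  · exact Real.toNNReal_le_one.2 (hφ x).2
  · have : φ x = 0 := hφ0 hx
    simp [this]
  · have : φ x = 1 := hφ1 hx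
    simp [this]

/-- The measure of an open set is approximated from below by continuous compactly supported
functions. -/
def IsInnerApprox {X : Type*} [TopologicalSpace X] [MeasurableSpace X] (μ : Measure X) : Prop :=
  ∀ U : Set X, IsOpen U → ∀ c < μ U, ∃ h : X → ℝ≥0, IsTestBelow U h ∧ c < ∫⁻ x, h x ∂μ

theorem ENNReal.le_liminf_of_forall_le_add {a : ℝ≥0∞} {b : ℕ → ℝ≥0∞}
    (h : ∀ n : ℕ, a ≤ b n + ((n + 1 : ℕ) : ℝ≥0∞)⁻¹) : a ≤ liminf b atTop := by
  have ht : Tendsto (fun n : ℕ => a - ((n + 1 : ℕ) : ℝ≥0∞)⁻¹) atTop (𝓝 a) := by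
    have h0 : Tendsto (fun n : ℕ => ((n + 1 : ℕ) : ℝ≥0∞)⁻¹) atTop (𝓝 0) :=
      ENNReal.tendsto_inv_nat_nhds_zero.comp (tendsto_add_atTop_nat 1)
    simpa using ENNReal.Tendsto.sub tendsto_const_nhds h0 (Or.inr ENNReal.zero_ne_top)
  rw [← ht.liminf_eq]
  exact liminf_le_liminf (.of_forall fun n => tsub_le_iff_right.2 (h n))

variable {X Y : Type*} [TopologicalSpace X] [T2Space X] [LocallyCompactSpace X]
  [MeasurableSpace X] [BorelSpace X] [TopologicalSpace Y] [T2Space Y] [LocallyCompactSpace Y]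
  [MeasurableSpace Y] [BorelSpace Y]

theorem isInnerApprox_of_regular (μ : Measure X) [μ.Regular] : IsInnerApprox μ := by
  intro U hU c hc
  obtain ⟨C, hCU, hC, hlt⟩ := hU.exists_lt_isCompact hc
  obtain ⟨h, hh, h1⟩ := exists_isTestBelow hC hU hCU
  refine ⟨h, hh, hlt.trans_le ?_⟩
  rw [← lintegral_indicator_one hC.measurableSet]
  refine lintegral_mono fun x => ?_
  by_cases hx : x ∈ C
  · simp [hx, h1 x hx]
  · simp [hx]

/-- Every test function below `U` gives a continuous lower bound for `ρ x U`, and these bounds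
approach it. -/
theorem lowerSemicontinuous_measure_of_isInnerApprox {ρ : X → Measure Y}
    (hcont : ∀ h : Y → ℝ≥0, IsTestBelow univ h → Continuous fun x => ∫⁻ y, h y ∂(ρ x))
    (hρ : ∀ x, IsInnerApprox (ρ x)) {U : Set Y} (hU : IsOpen U) :
    LowerSemicontinuous fun x => ρ x U := by
  intro x c hc
  obtain ⟨h, hh, hlt⟩ := hρ x U hU c hc
  filter_upwards [(hcont h (hh.mono (subset_univ _))).continuousAt.eventually_const_lt hlt]
    with x' hx'
  exact hx'.trans_le (hh.lintegral_le hU _)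

theorem measurable_of_isInnerApprox {ρ : X → Measure Y} [∀ x, IsProbabilityMeasure (ρ x)]
    (hcont : ∀ h : Y → ℝ≥0, IsTestBelow univ h → Continuous fun x => ∫⁻ y, h y ∂(ρ x))
    (hρ : ∀ x, IsInnerApprox (ρ x)) : Measurable ρ :=
  Measurable.measure_of_isPiSystem_of_isProbabilityMeasure
    (S := {s | IsOpen s}) BorelSpace.measurable_eq isPiSystem_isOpen
    fun _ hU => (lowerSemicontinuous_measure_of_isInnerApprox hcont hρ hU).measurable

/-- On a compact set of points where `ρ x U > t`, a single test function witnesses this. -/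
theorem exists_isTestBelow_forall_mem_lt {ρ : X → Measure Y}
    (hcont : ∀ h : Y → ℝ≥0, IsTestBelow univ h → Continuous fun x => ∫⁻ y, h y ∂(ρ x))
    (hρ : ∀ x, IsInnerApprox (ρ x)) {U : Set Y} (hU : IsOpen U) {C : Set X} (hC : IsCompact C)
    {t : ℝ≥0∞} (ht : ∀ x ∈ C, t < ρ x U) :
    ∃ h, IsTestBelow U h ∧ ∀ x ∈ C, t < ∫⁻ y, h y ∂(ρ x) := by
  refine hC.induction_on (p := fun S => ∃ h, IsTestBelow U h ∧ ∀ x ∈ S, t < ∫⁻ y, h y ∂(ρ x))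
    ⟨0, .zero U, by simp⟩ (fun S T hST ⟨h, hh, hT⟩ => ⟨h, hh, fun x hx => hT x (hST hx)⟩) ?_ ?_
  · rintro S T ⟨g, hg, hS⟩ ⟨h, hh, hT⟩
    refine ⟨g ⊔ h, hg.sup hh, fun x hx => ?_⟩
    rcases hx with hx | hx
    · exact (hS x hx).trans_le (lintegral_mono fun y => by simp)
    · exact (hT x hx).trans_le (lintegral_mono fun y => by simp)
  · intro x hx
    obtain ⟨h, hh, hlt⟩ := hρ x U hU t (ht x hx)
    exact ⟨_, mem_nhdsWithin_of_mem_nhds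
      ((hcont h (hh.mono (subset_univ _))).continuousAt.eventually_const_lt hlt), h, hh,
      fun _ h => h⟩

/-- At least `⌈a * (N + 1)⌉ - 1` of the levels lie strictly below `a`; the final summand pays for
the missing one. -/
theorem ENNReal.le_sum_ite_lt_add_inv {N : ℕ} {a : ℝ≥0∞} (ha : a ≤ 1) :
    a ≤ (∑ k ∈ Finset.range (N + 1), if ((k + 1 : ℕ) : ℝ≥0∞) / (N + 1 : ℕ) < a then
      ((N + 1 : ℕ) : ℝ≥0∞)⁻¹ else 0) + ((N + 1 : ℕ) : ℝ≥0∞)⁻¹ := by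
  have hn0 : ((N + 1 : ℕ) : ℝ≥0∞) ≠ 0 := by simp
  have hnt : ((N + 1 : ℕ) : ℝ≥0∞) ≠ ∞ := ENNReal.natCast_ne_top _
  lift a to ℝ≥0 using (ha.trans_lt ENNReal.one_lt_top).ne
  have ha' : a ≤ 1 := by exact_mod_cast ha
  set J := ⌈a * (N + 1 : ℕ)⌉₊ with hJ
  have hJN : J ≤ N + 1 := Nat.ceil_le.2 (mul_le_of_le_one_left (by positivity) ha')
  have hsub : Finset.range (J - 1) ⊆ (Finset.range (N + 1)).filter
      fun k => ((k + 1 : ℕ) : ℝ≥0∞) / (N + 1 : ℕ) < a := by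
    intro k hk
    have hk := Finset.mem_range.1 hk
    refine Finset.mem_filter.2 ⟨Finset.mem_range.2 (by omega), ?_⟩
    rw [ENNReal.div_lt_iff (Or.inl hn0) (Or.inl hnt)]
    have : ((k + 1 : ℕ) : ℝ≥0) < a * (N + 1 : ℕ) := Nat.lt_ceil.1 (by omega)
    exact_mod_cast this
  have hcard := Finset.card_le_card hsub
  rw [Finset.card_range] at hcard
  rw [← Finset.sum_filter, Finset.sum_const, nsmul_eq_mul, ← add_one_mul, ← div_eq_mul_inv,
    ENNReal.le_div_iff_mul_le (Or.inl hn0) (Or.inl hnt)]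
  have h1 : a * (N + 1 : ℕ) ≤ (J : ℝ≥0) := Nat.le_ceil _
  have h2 : ((a * (N + 1 : ℕ) : ℝ≥0) : ℝ≥0∞) ≤ (J : ℝ≥0∞) := by exact_mod_cast h1
  push_cast at h2 ⊢
  refine h2.trans ?_
  exact_mod_cast (by omega : J ≤ _ + 1)

/-- Mixing a weakly continuous family of inner approximable probability measures by a regular
measure gives an inner approximable measure. -/
theorem isInnerApprox_bind (ω : Measure X) [ω.Regular] {ρ : X → Measure Y}
    [∀ x, IsProbabilityMeasure (ρ x)]
    (hcont : ∀ h : Y → ℝ≥0, IsTestBelow univ h → Continuous fun x => ∫⁻ y, h y ∂(ρ x))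
    (hρ : ∀ x, IsInnerApprox (ρ x)) : IsInnerApprox (ω.bind ρ) := by
  intro U hU c hc
  have hm := measurable_of_isInnerApprox hcont hρ
  rw [Measure.bind_apply hU.measurableSet hm.aemeasurable] at hc
  have hlsc := lowerSemicontinuous_measure_of_isInnerApprox hcont hρ hU
  -- Discrete layer cake: the superlevel sets are open by semicontinuity, so `ω` can be approximated
  -- on them by compact sets.
  set V : ℕ → ℕ → Set X := fun N k => {x | ((k + 1 : ℕ) : ℝ≥0∞) / (N + 1 : ℕ) < ρ x U} with hV
  have hVo : ∀ N k, IsOpen (V N k) := fun N k => hlsc.isOpen_preimage _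
  set ψ : ℕ → X → ℝ≥0∞ := fun N x => ∑ k ∈ Finset.range (N + 1),
    (V N k).indicator (fun _ => ((N + 1 : ℕ) : ℝ≥0∞)⁻¹) x with hψ
  have hψm : ∀ N, Measurable (ψ N) := fun N =>
    Finset.measurable_fun_sum _ fun k _ => measurable_const.indicator (hVo N k).measurableSet
  obtain ⟨N, hN⟩ : ∃ N, c < ∫⁻ x, ψ N x ∂ω := by
    by_contra! hle
    refine hc.not_ge ?_
    calc ∫⁻ x, ρ x U ∂ω ≤ ∫⁻ x, liminf (fun N => ψ N x) atTop ∂ω :=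
          lintegral_mono fun x => ENNReal.le_liminf_of_forall_le_add fun N =>
            by
              simp only [ψ, V, indicator_apply, mem_ofPred_eq]
              exact ENNReal.le_sum_ite_lt_add_inv prob_le_one
      _ ≤ liminf (fun N => ∫⁻ x, ψ N x ∂ω) atTop := lintegral_liminf_le hψm
      _ ≤ c := liminf_le_of_frequently_le' (Frequently.of_forall hle)
  have hsum : ∫⁻ x, ψ N x ∂ω = ∑ k ∈ Finset.range (N + 1), ((N + 1 : ℕ) : ℝ≥0∞)⁻¹ * ω (V N k) := by
    rw [hψ, lintegral_finsetSum _ fun k _ => measurable_const.indicator (hVo N k).measurableSet]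
    exact Finset.sum_congr rfl fun k _ => lintegral_indicator_const (hVo N k).measurableSet _
  -- Choosing the compact sets for all levels at once gives a family directed under union, so the
  -- supremum leaves the finite sum.
  let I := {C : ℕ → Set X // ∀ k, IsCompact (C k) ∧ C k ⊆ V N k}
  have hsup : ∀ k, ((N + 1 : ℕ) : ℝ≥0∞)⁻¹ * ω (V N k) =
      ⨆ C : I, ((N + 1 : ℕ) : ℝ≥0∞)⁻¹ * ω (C.1 k) := by
    intro k
    rw [← ENNReal.mul_iSup]
    congr 1
    refine le_antisymm (le_of_forall_lt fun r hr => ?_)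
      (iSup_le fun C => measure_mono (C.2 k).2)
    obtain ⟨C, hCV, hC, hlt⟩ := (hVo N k).exists_lt_isCompact hr
    refine lt_iSup_iff.2 ⟨⟨fun j => if j = k then C else ∅, fun j => ?_⟩, by simpa using hlt⟩
    by_cases h : j = k
    · simpa [h] using ⟨hC, hCV⟩
    · simp [h]
  simp only [hsum, hsup] at hN
  rw [ENNReal.finsetSum_iSup fun C D : I => ⟨⟨fun k => C.1 k ∪ D.1 k, fun k =>
    ⟨(C.2 k).1.union (D.2 k).1, union_subset (C.2 k).2 (D.2 k).2⟩⟩, fun k =>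
    ⟨by gcongr; exact subset_union_left, by gcongr; exact subset_union_right⟩⟩] at hN
  obtain ⟨C, hN⟩ := lt_iSup_iff.1 hN
  choose H hH hHlt using fun k => exists_isTestBelow_forall_mem_lt hcont hρ hU (C.2 k).1
    (t := ((k + 1 : ℕ) : ℝ≥0∞) / (N + 1 : ℕ)) fun x hx => (C.2 k).2 hx
  obtain ⟨h, hh, hle⟩ : ∃ h, IsTestBelow U h ∧ ∀ k ∈ Finset.range (N + 1), H k ≤ h := by
    induction Finset.range (N + 1) using Finset.induction_on with
    | empty => exact ⟨0, .zero U, by simp⟩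
    | insert k s _ ih =>
      obtain ⟨h, hh, hle⟩ := ih
      refine ⟨H k ⊔ h, (hH k).sup hh, fun j hj => ?_⟩
      rcases Finset.mem_insert.1 hj with rfl | hj
      · exact le_sup_left
      · exact (hle j hj).trans le_sup_right
  refine ⟨h, hh, hN.trans_le ?_⟩
  rw [Measure.lintegral_bind hm.aemeasurable 
    hh.continuous.measurable.coe_nnreal_ennreal.aemeasurable]
  calc ∑ k ∈ Finset.range (N + 1), ((N + 1 : ℕ) : ℝ≥0∞)⁻¹ * ω (C.1 k)
      = ∫⁻ x, ∑ k ∈ Finset.range (N + 1),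
          (C.1 k).indicator (fun _ => ((N + 1 : ℕ) : ℝ≥0∞)⁻¹) x ∂ω := by
        rw [lintegral_finsetSum _ fun k _ =>
          measurable_const.indicator (C.2 k).1.measurableSet]
        exact Finset.sum_congr rfl fun k _ =>
          (lintegral_indicator_const (C.2 k).1.measurableSet _).symm
    _ ≤ ∫⁻ x, ∫⁻ y, h y ∂(ρ x) ∂ω := by
        refine lintegral_mono fun x => ?_
        classical
        set s := (Finset.range (N + 1)).filter fun k => x ∈ C.1 k with hs
        have h1 : ∑ k ∈ Finset.range (N + 1),
            (C.1 k).indicator (fun _ => ((N + 1 : ℕ) : ℝ≥0∞)⁻¹) x =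
            s.card * ((N + 1 : ℕ) : ℝ≥0∞)⁻¹ := by
          simp only [indicator_apply]
          rw [← Finset.sum_filter, Finset.sum_const, nsmul_eq_mul]
        rw [h1]
        rcases s.eq_empty_or_nonempty with h0 | hne
        · simp [h0]
        obtain ⟨hjr, hjx⟩ := Finset.mem_filter.1 (s.max'_mem hne)
        -- The layers containing `x` number at most one more than the top index, and at that index
        -- the test function already integrates to more than `(max + 1) / (N + 1)`.
        have hcard : s.card ≤ s.max' hne + 1 := by
          refine (Finset.card_le_card fun k hk => ?_).trans_eq (Finset.card_range _)
          exact Finset.mem_range.2 (Nat.lt_succ_of_le (s.le_max' k hk))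
        calc (s.card : ℝ≥0∞) * ((N + 1 : ℕ) : ℝ≥0∞)⁻¹
            ≤ ((s.max' hne + 1 : ℕ) : ℝ≥0∞) / (N + 1 : ℕ) := by
              rw [div_eq_mul_inv]
              gcongr
          _ ≤ ∫⁻ y, H (s.max' hne) y ∂(ρ x) := (hHlt _ x hjx).le
          _ ≤ ∫⁻ y, h y ∂(ρ x) := lintegral_mono fun y =>
              ENNReal.coe_le_coe.2 (hle _ hjr y)

/-- Test functions control open sets by inner approximability of the mixture, and open sets control
Borel sets by outer regularity of `ω`. -/
theorem bind_le_of_forall_lintegral_le (ω : Measure X) [ω.Regular] {ρ : X → Measure X}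
    [∀ x, IsProbabilityMeasure (ρ x)]
    (hcont : ∀ h : X → ℝ≥0, IsTestBelow univ h → Continuous fun x => ∫⁻ y, h y ∂(ρ x))
    (hρ : ∀ x, IsInnerApprox (ρ x))
    (hle : ∀ h : X → ℝ≥0, IsTestBelow univ h →
      ∫⁻ x, ∫⁻ y, h y ∂(ρ x) ∂ω ≤ ∫⁻ x, h x ∂ω) : ω.bind ρ ≤ ω := by
  have hm := measurable_of_isInnerApprox hcont hρ
  have hopen : ∀ U, IsOpen U → ω.bind ρ U ≤ ω U := fun U hU => by
    by_contra! hlt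
    obtain ⟨h, hh, hlt⟩ := isInnerApprox_bind ω hcont hρ U hU _ hlt
    rw [Measure.lintegral_bind hm.aemeasurable 
      hh.continuous.measurable.coe_nnreal_ennreal.aemeasurable] at hlt
    exact (hlt.trans_le ((hle h (hh.mono (subset_univ _))).trans (hh.lintegral_le hU ω))).false
  refine Measure.le_iff.2 fun B hB => le_of_forall_gt fun r hr => ?_
  obtain ⟨U, hBU, hU, hlt⟩ := B.exists_isOpen_lt_of_lt r hr
  exact ((measure_mono hBU).trans (hopen U hU)).trans_lt hlt

end RadonKernels

/-! ### Tonelli with compact supports, and density in `L¹` -/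

section Lintegral

open Filter Set
open scoped ENNReal NNReal

variable {X Y : Type*} [TopologicalSpace X] [T2Space X] [LocallyCompactSpace X]
  [MeasurableSpace X] [BorelSpace X] [TopologicalSpace Y]

theorem continuous_lintegral_of_le_one (m : Measure X) [IsFiniteMeasure m] [m.Regular]
    {b : Y → X → ℝ≥0} (hb : Continuous b.uncurry) (h1 : ∀ y x, b y x ≤ 1) :
    Continuous fun y => ∫⁻ x, b y x ∂m := by
  have hbd : ∀ y x, ‖((b y x : ℝ) : ℂ)‖ ≤ 1 := fun y x => by simpa using h1 y x
  have hc : Continuous (Function.uncurry fun y x => ((b y x : ℝ) : ℂ)) :=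
    Complex.continuous_ofReal.comp (NNReal.continuous_coe.comp hb)
  have hby : ∀ y, Continuous (b y) := fun y => hb.comp (by fun_prop : Continuous fun x => (y, x))
  have hI : ∀ y, ∫⁻ x, b y x ∂m = ENNReal.ofReal (∫ x, ((b y x : ℝ) : ℂ) ∂m).re := fun y => by
    rw [integral_complex_ofReal, Complex.ofReal_re]
    refine lintegral_coe_eq_integral _ (.of_bound ?_ 1 (.of_forall fun x => ?_))
    · exact (NNReal.continuous_coe.comp (hby y)).aestronglyMeasurable
    · simpa using h1 y x
  simp only [hI]
  exact ENNReal.continuous_ofReal.comp (Complex.continuous_re.comp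
    (continuous_integral_of_bounded m hc hbd))

theorem lintegral_lintegral_swap_of_compact [T2Space Y] [LocallyCompactSpace Y] [MeasurableSpace Y]
    [BorelSpace Y] (m : Measure X) (n : Measure Y) [IsFiniteMeasureOnCompacts m]
    [IsFiniteMeasureOnCompacts n] {b : X → Y → ℝ≥0} (hb : Continuous b.uncurry) {C : Set X}
    {D : Set Y} (hC : IsCompact C) (hD : IsCompact D) (h0 : ∀ x y, b x y ≠ 0 → x ∈ C ∧ y ∈ D) :
    ∫⁻ x, ∫⁻ y, b x y ∂n ∂m = ∫⁻ y, ∫⁻ x, b x y ∂m ∂n := by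
  have hbr : Continuous (Function.uncurry fun x y => (b x y : ℝ)) := NNReal.continuous_coe.comp hb
  have hbx : ∀ x, Continuous fun y => (b x y : ℝ) := fun x =>
    hbr.comp (by fun_prop : Continuous fun y => (x, y))
  have hby : ∀ y, Continuous fun x => (b x y : ℝ) := fun y =>
    hbr.comp (by fun_prop : Continuous fun x => (x, y))
  have hx : ∀ x, ∫⁻ y, b x y ∂n = ENNReal.ofReal (∫ y, (b x y : ℝ) ∂n) := fun x =>
    lintegral_coe_eq_integral _ ((hbx x).integrable_of_hasCompactSupport
      (HasCompactSupport.intro hD fun y hy => by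
        by_contra h; exact hy (h0 x y (by simpa using h)).2))
  have hy : ∀ y, ∫⁻ x, b x y ∂m = ENNReal.ofReal (∫ x, (b x y : ℝ) ∂m) := fun y =>
    lintegral_coe_eq_integral _ ((hby y).integrable_of_hasCompactSupport
      (HasCompactSupport.intro hC fun x hx => by
        by_contra h; exact hx (h0 x y (by simpa using h)).1))
  simp only [hx, hy]
  have hcx : Continuous fun x => ∫ y, (b x y : ℝ) ∂n := by
    rw [← continuousOn_univ]
    refine continuousOn_integral_of_compact_support hD hbr.continuousOn fun x y _ hy => ?_
    by_contra h; exact hy (h0 x y (by simpa using h)).2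
  have hcy : Continuous fun y => ∫ x, (b x y : ℝ) ∂m := by
    rw [← continuousOn_univ]
    refine continuousOn_integral_of_compact_support (f := fun y x => (b x y : ℝ)) hC
      (hbr.comp continuous_swap).continuousOn fun y x _ hx => ?_
    by_contra h; exact hx (h0 x y (by simpa using h)).1
  rw [← ofReal_integral_eq_lintegral_ofReal (hcx.integrable_of_hasCompactSupport
      (HasCompactSupport.intro hC fun x hx => integral_eq_zero_of_ae (.of_forall fun y => by
        by_contra h; exact hx (h0 x y (by simpa using h)).1)))
      (.of_forall fun x => integral_nonneg fun y => (b x y).2),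
    ← ofReal_integral_eq_lintegral_ofReal (hcy.integrable_of_hasCompactSupport
      (HasCompactSupport.intro hD fun y hy => integral_eq_zero_of_ae (.of_forall fun x => by
        by_contra h; exact hy (h0 x y (by simpa using h)).2)))
      (.of_forall fun y => integral_nonneg fun x => (b x y).2)]
  congr 1
  refine integral_integral_swap_of_hasCompactSupport (f := fun x y => (b x y : ℝ)) hbr
    (HasCompactSupport.intro (hC.prod hD) fun p hp => ?_)
  by_contra h
  exact hp (h0 p.1 p.2 (by simpa [Function.uncurry] using h))

/-- A measurable set of finite measure is, up to a small set, a continuous compactly supported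
function. -/
theorem exists_isTestBelow_eq_indicator (ω : Measure X) [ω.Regular] {s : Set X}
    (hs : MeasurableSet s) (hfin : ω s ≠ ∞) {δ : ℝ≥0∞} (hδ : δ ≠ 0) :
    ∃ h : X → ℝ≥0, IsTestBelow univ h ∧ ∃ D, MeasurableSet D ∧ ω D < δ ∧
      ∀ x ∉ D, h x = s.indicator 1 x := by
  have hδ2 : δ / 2 ≠ 0 := (ENNReal.half_pos hδ).ne'
  obtain ⟨C, hCs, hC, hlt⟩ := hs.exists_isCompact_sdiff_lt hfin hδ2
  obtain ⟨U, hsU, hU, hUfin, hUlt⟩ := hs.exists_isOpen_sdiff_lt hfin hδ2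
  obtain ⟨h, hh, h1⟩ := exists_isTestBelow hC hU (hCs.trans hsU)
  refine ⟨h, hh.mono (subset_univ _), (s \ C) ∪ (U \ s), (hs.diff hC.measurableSet).union
    (hU.measurableSet.diff hs), ?_, fun x hx => ?_⟩
  · exact (measure_union_le _ _).trans_lt ((ENNReal.add_lt_add hlt hUlt).trans_eq
      (ENNReal.add_halves δ))
  · by_cases hxs : x ∈ s
    · have : x ∈ C := by
        by_contra hxC
        exact hx (Or.inl ⟨hxs, hxC⟩)
      simp [hxs, h1 x this]
    · have : x ∉ U := fun hxU => hx (Or.inr ⟨hxU, hxs⟩)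
      simp [hxs, hh.eq_zero x this]

theorem IsTestBelow.enorm_indicator_sub_le {s D : Set X} {h : X → ℝ≥0} (hh : IsTestBelow univ h)
    (hD : ∀ x ∉ D, h x = s.indicator 1 x) (c : ℂ) (x : X) :
    ‖(h x : ℂ) * c - s.indicator (fun _ => c) x‖ₑ ≤ D.indicator (fun _ => ‖c‖ₑ) x := by
  by_cases hx : x ∈ D
  · have h1 : (h x : ℝ) ≤ 1 := hh.le_one x
    rw [indicator_of_mem hx, enorm_le_iff_norm_le]
    by_cases hs : x ∈ s
    · rw [indicator_of_mem hs, ← sub_one_mul, norm_mul,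
        show ((h x : ℂ) - 1) = (((h x : ℝ) - 1 : ℝ) : ℂ) by push_cast; rfl, Complex.norm_real,
        Real.norm_eq_abs, abs_sub_comm, abs_of_nonneg (sub_nonneg.2 h1)]
      exact mul_le_of_le_one_left (norm_nonneg _) (by linarith [(h x).2])
    · rw [indicator_of_notMem hs, sub_zero, norm_mul]
      exact mul_le_of_le_one_left (norm_nonneg _) (by simpa using h1)
  · rw [hD x hx]
    by_cases hs : x ∈ s <;> simp [hs]

/-- Continuous compactly supported functions are dense in `L¹` of a regular measure on a locally
compact space. -/
theorem MeasureTheory.Integrable.exists_continuous_lintegral_sub_le {ω : Measure X}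
    [ω.Regular] {f : X → ℂ} (hf : Integrable f ω) {ε : ℝ≥0∞} (hε : ε ≠ 0) :
    ∃ h : X → ℂ, ∫⁻ x, ‖f x - h x‖ₑ ∂ω ≤ ε ∧ Continuous h ∧ HasCompactSupport h := by
  have hadd : ∀ f g : X → ℂ, (Continuous f ∧ HasCompactSupport f) →
      (Continuous g ∧ HasCompactSupport g) → Continuous (f + g) ∧ HasCompactSupport (f + g) :=
    fun f g hf hg => ⟨hf.1.add hg.1, hf.2.add hg.2⟩
  have hind : ∀ (c : ℂ) ⦃s : Set X⦄, MeasurableSet s → ω s < ∞ → ∀ {ε : ℝ≥0∞}, ε ≠ 0 →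
      ∃ g : X → ℂ, eLpNorm (g - s.indicator fun _ => c) 1 ω ≤ ε ∧
        (Continuous g ∧ HasCompactSupport g) := by
    intro c s hs hlt ε hε
    -- For `c = 0` the quotient is `∞`, which is harmless.
    have hδ : ε / ‖c‖ₑ ≠ 0 := by simp [ENNReal.div_eq_zero_iff, hε]
    obtain ⟨h, hh, D, hDm, hDlt, hD⟩ := exists_isTestBelow_eq_indicator ω hs hlt.ne hδ
    refine ⟨fun x => (h x : ℂ) * c, ?_, ?_, ?_⟩
    · rw [eLpNorm_one_eq_lintegral_enorm]
      refine (lintegral_mono (hh.enorm_indicator_sub_le hD c)).trans ?_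
      rw [lintegral_indicator_const hDm, mul_comm]
      exact ENNReal.mul_le_of_le_div hDlt.le
    · have := hh.continuous
      fun_prop
    · exact (hh.hasCompactSupport.comp_left (g := fun r : ℝ≥0 => (r : ℂ) * c) (by simp))
  obtain ⟨h, hle, hc, hcs⟩ := MemLp.induction_dense ENNReal.one_ne_top
    (fun h : X → ℂ => Continuous h ∧ HasCompactSupport h) hind hadd
    (fun f hf => hf.1.aestronglyMeasurable) (memLp_one_iff_integrable.2 hf) hε
  exact ⟨h, by simpa [eLpNorm_one_eq_lintegral_enorm] using hle, hc, hcs⟩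

/-- An indicator of finite measure agrees with a test function off a set `D` of small measure, and
absolute continuity of the integral makes `∫ ‖f‖` over `D` small. -/
theorem MeasureTheory.Integrable.ae_eq_zero_of_forall_integral_mul_eq_zero {ω : Measure X}
    [ω.Regular] {f : X → ℂ} (hf : Integrable f ω)
    (h : ∀ g : X → ℂ, Continuous g → HasCompactSupport g → ∫ x, g x * f x ∂ω = 0) :
    f =ᵐ[ω] 0 := by
  refine hf.ae_eq_zero_of_forall_setIntegral_eq_zero fun s hs hlt => ?_
  rw [← enorm_eq_zero]
  refine le_antisymm (ENNReal.le_of_forall_pos_le_add fun ε hε _ => ?_) zero_le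
  obtain ⟨δ, hδ, hδs⟩ := exists_pos_setLIntegral_lt_of_measure_lt hf.2.ne
    (ε := (ε : ℝ≥0∞)) (by simpa using hε.ne')
  obtain ⟨g, hg, D, hDm, hDlt, hD⟩ := exists_isTestBelow_eq_indicator ω hs hlt.ne hδ.ne'
  have hgc : Continuous fun x => (g x : ℂ) := by have := hg.continuous; fun_prop
  have h0 := h (fun x => (g x : ℂ)) hgc
    (hg.hasCompactSupport.comp_left (g := fun r : ℝ≥0 => (r : ℂ)) (by simp))
  have hgf : Integrable (fun x => (g x : ℂ) * f x) ω :=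
    hf.bdd_mul hgc.aestronglyMeasurable (c := 1) (.of_forall fun x => by simpa using hg.le_one x)
  rw [zero_add, ← enorm_neg, ← integral_indicator hs, ← zero_sub, ← h0,
    ← integral_sub hgf (hf.indicator hs)]
  refine (enorm_integral_le_lintegral_enorm _).trans (le_trans ?_ (hδs D hDlt).le)
  rw [← lintegral_indicator hDm]
  refine lintegral_mono fun x => ?_
  have := hg.enorm_indicator_sub_le hD (f x) x
  by_cases hx : x ∈ s <;> by_cases hxD : x ∈ D <;> simpa [hx, hxD] using this

end Lintegral

/-! ### Haar measure: contractivity of translation and of `σ *` -/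

namespace Hypergroup

open Filter Set ProbabilityTheory
open scoped ENNReal NNReal

variable {K : Type*} [TopologicalSpace K] [T2Space K] [LocallyCompactSpace K]
  [MeasurableSpace K] [BorelSpace K] [Hypergroup K]

/-- `h(x * y)` for a nonnegative function `h`. -/
noncomputable def nnTranslate (h : K → ℝ≥0) (x y : K) : ℝ≥0 :=
  (∫⁻ t, h t ∂(conv x y : Measure K)).toNNReal

section NNTranslate

variable {h : K → ℝ≥0}

theorem coe_nnTranslate (hh : IsTestBelow univ h) (x y : K) :
    (nnTranslate h x y : ℝ≥0∞) = ∫⁻ t, h t ∂(conv x y : Measure K) := by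
  refine ENNReal.coe_toNNReal (ne_top_of_le_ne_top ENNReal.one_ne_top ?_)
  exact (hh.lintegral_le isOpen_univ _).trans prob_le_one

theorem nnTranslate_le_one (hh : IsTestBelow univ h) (x y : K) : nnTranslate h x y ≤ 1 := by
  have := (hh.lintegral_le isOpen_univ (conv x y : Measure K)).trans prob_le_one
  rw [← coe_nnTranslate hh] at this
  exact_mod_cast this

theorem continuous_lintegral_conv (hh : IsTestBelow univ h) :
    Continuous fun p : K × K => ∫⁻ t, h t ∂(conv p.1 p.2 : Measure K) := by
  rw [continuous_iff_continuousAt]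
  intro p
  exact (ProbabilityMeasure.tendsto_iff_forall_lintegral_tendsto.1 (continuous_conv.tendsto p))
    (BoundedContinuousFunction.mkOfBound ⟨h, hh.continuous⟩ 1 fun x y => by
      rw [NNReal.dist_eq, abs_le]
      have h1 : (h x : ℝ) ≤ 1 := hh.le_one x
      have h2 : (h y : ℝ) ≤ 1 := hh.le_one y
      have h3 := (h x).2
      have h4 := (h y).2
      constructor <;> simp <;> linarith)

theorem continuous_nnTranslate (hh : IsTestBelow univ h) :
    Continuous (Function.uncurry (nnTranslate h)) := by
  rw [← ENNReal.continuous_coe_iff]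
  exact (continuous_lintegral_conv hh).congr fun p => (coe_nnTranslate hh p.1 p.2).symm

theorem translate_coe (hh : IsTestBelow univ h) (x y : K) :
    translate (fun t => ((h t : ℝ) : ℂ)) x y = ((nnTranslate h x y : ℝ) : ℂ) := by
  have hI : ∫ t, (h t : ℝ) ∂(conv x y : Measure K) = (nnTranslate h x y : ℝ) := by
    rw [integral_eq_lintegral_of_nonneg_ae (f := fun t => (h t : ℝ))
      (.of_forall fun t => (h t).2) (NNReal.continuous_coe.comp hh.continuous).aestronglyMeasurable]
    simp [nnTranslate, ENNReal.toReal]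
  rw [translate, integral_complex_ofReal, hI]

theorem exists_mem_support_of_nnTranslate_ne_zero {x y : K} (hne : nnTranslate h x y ≠ 0) :
    ∃ t ∈ (conv x y : Measure K).support, h t ≠ 0 := by
  by_contra! hc
  refine hne ?_
  rw [nnTranslate, lintegral_congr_ae (g := 0)
    ((ae_mem_support_conv x y).mono fun t ht => by simp [hc t ht])]
  simp

theorem lintegral_nnTranslate {ω : Measure K} (hω : IsLeftHaar ω) (hh : IsTestBelow univ h)
    (z : K) : ∫⁻ y, nnTranslate h z y ∂ω = ∫⁻ y, h y ∂ω := by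
  have := hω.regular
  have hhr : Continuous fun y => (h y : ℝ) := NNReal.continuous_coe.comp hh.continuous
  have hTr : Continuous fun y => (nnTranslate h z y : ℝ) := NNReal.continuous_coe.comp
    ((continuous_nnTranslate hh).comp (by fun_prop : Continuous fun y : K => (z, y)))
  have hTs : HasCompactSupport fun y => (nnTranslate h z y : ℝ) := by
    refine HasCompactSupport.intro (isCompact_setMul (isCompact_singleton (x := inv z))
      hh.hasCompactSupport.isCompact) fun y hy => ?_
    by_contra hne
    obtain ⟨t, ht, hft⟩ := exists_mem_support_of_nnTranslate_ne_zero (h := h) (x := z) (y := y)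
      (by simpa using hne)
    exact hy (mem_setMul.2 ⟨_, rfl, t, subset_tsupport _ hft, mem_support_inv_conv ht⟩)
  have key := hω.left_invariant z ⟨⟨fun y => ((h y : ℝ) : ℂ), Complex.continuous_ofReal.comp hhr⟩,
    hh.hasCompactSupport.comp_left (g := fun r : ℝ≥0 => ((r : ℝ) : ℂ)) (by simp)⟩
  change ∫ y, translate (fun t => ((h t : ℝ) : ℂ)) z y ∂ω = ∫ y, ((h y : ℝ) : ℂ) ∂ω at key
  simp only [translate_coe hh, integral_complex_ofReal] at key
  rw [lintegral_coe_eq_integral _ (hTr.integrable_of_hasCompactSupport hTs),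
    lintegral_coe_eq_integral _ (hhr.integrable_of_hasCompactSupport
      (hh.hasCompactSupport.comp_left (g := fun r : ℝ≥0 => (r : ℝ)) rfl)), Complex.ofReal_inj.1 key]

end NNTranslate

theorem continuous_lintegral_conv_left (z : K) (h : K → ℝ≥0) (hh : IsTestBelow univ h) :
    Continuous fun y => ∫⁻ t, h t ∂(conv z y : Measure K) :=
  (continuous_lintegral_conv hh).comp (by fun_prop : Continuous fun y : K => (z, y))

theorem continuous_lintegral_conv_inv (x : K) (h : K → ℝ≥0) (hh : IsTestBelow univ h) :
    Continuous fun y => ∫⁻ t, h t ∂(conv (inv y) x : Measure K) :=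
  (continuous_lintegral_conv hh).comp
    ((continuous_inv.prodMk continuous_const : Continuous fun y : K => (inv y, x)))

theorem measurable_conv (z : K) : Measurable fun y => (conv z y : Measure K) :=
  measurable_of_isInnerApprox (continuous_lintegral_conv_left z)
    fun _ => isInnerApprox_of_regular _

theorem measurable_conv_inv (x : K) : Measurable fun y => (conv (inv y) x : Measure K) :=
  measurable_of_isInnerApprox (continuous_lintegral_conv_inv x)
    fun _ => isInnerApprox_of_regular _

/-- Inequality is all that the `L¹` estimates need; in particular, `ω`-null sets are null for `δ_z *
δ_y` for almost every `y`. -/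
theorem bind_conv_le {ω : Measure K} (hω : IsLeftHaar ω) (z : K) :
    ω.bind (fun y => (conv z y : Measure K)) ≤ ω := by
  have := hω.regular
  refine bind_le_of_forall_lintegral_le ω (continuous_lintegral_conv_left z)
    (fun _ => isInnerApprox_of_regular _) fun h hh => ?_
  simp only [← coe_nnTranslate hh]
  exact (lintegral_nnTranslate hω hh z).le

/-- The measure `f ↦ (σ * f)(x)`. -/
noncomputable def convMeasure (σ : Measure K) (x : K) : Measure K :=
  σ.bind fun y => (conv (inv y) x : Measure K)

instance isProbabilityMeasure_convMeasure (σ : Measure K) [IsProbabilityMeasure σ] (x : K) :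
    IsProbabilityMeasure (convMeasure σ x) := by
  constructor
  rw [convMeasure, Measure.bind_apply MeasurableSet.univ (measurable_conv_inv x).aemeasurable]
  simp

theorem lintegral_convMeasure (σ : Measure K) (x : K) {u : K → ℝ≥0∞} (hu : Measurable u) :
    ∫⁻ t, u t ∂(convMeasure σ x) = ∫⁻ y, ∫⁻ t, u t ∂(conv (inv y) x : Measure K) ∂σ :=
  Measure.lintegral_bind (measurable_conv_inv x).aemeasurable hu.aemeasurable

section ConvMeasure

variable (σ : Measure K) [IsProbabilityMeasure σ] [σ.Regular] {h : K → ℝ≥0}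

theorem continuous_nnTranslate_inv (hh : IsTestBelow univ h) :
    Continuous (Function.uncurry fun x y : K => nnTranslate h (inv y) x) :=
  (continuous_nnTranslate hh).comp ((continuous_inv.comp continuous_snd).prodMk continuous_fst)

theorem continuous_lintegral_convMeasure (h : K → ℝ≥0) (hh : IsTestBelow univ h) :
    Continuous fun x => ∫⁻ t, h t ∂(convMeasure σ x) := by
  simp only [lintegral_convMeasure σ _ hh.continuous.measurable.coe_nnreal_ennreal,
    ← coe_nnTranslate hh]
  exact continuous_lintegral_of_le_one σ (continuous_nnTranslate_inv hh)
    fun x y => nnTranslate_le_one hh _ _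

/-- Cutting off `σ` makes the integrand compactly supported in both variables, so Tonelli and left
invariance apply; Fatou then removes the cutoff. -/
theorem lintegral_convMeasure_le {ω : Measure K} (hω : IsLeftHaar ω) (hh : IsTestBelow univ h) :
    ∫⁻ x, ∫⁻ t, h t ∂(convMeasure σ x) ∂ω ≤ ∫⁻ x, h x ∂ω := by
  have := hω.regular
  simp only [lintegral_convMeasure σ _ hh.continuous.measurable.coe_nnreal_ennreal,
    ← coe_nnTranslate hh]
  have hC : ∀ n : ℕ, ∃ C, IsCompact C ∧ σ (univ \ C) < ((n + 1 : ℕ) : ℝ≥0∞)⁻¹ := fun n =>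
    let ⟨C, _, hC, hlt⟩ := MeasurableSet.univ.exists_isCompact_sdiff_lt (μ := σ)
      (measure_ne_top σ univ) (ε := ((n + 1 : ℕ) : ℝ≥0∞)⁻¹)
      (ENNReal.inv_ne_zero.2 (ENNReal.natCast_ne_top _))
    ⟨C, hC, hlt⟩
  choose C hC hCσ using hC
  choose φ hφ hφ1 using fun n => exists_isTestBelow (hC n) isOpen_univ (subset_univ _)
  have hb : ∀ n, Continuous (Function.uncurry fun x y => φ n y * nnTranslate h (inv y) x) :=
    fun n => ((hφ n).continuous.comp continuous_snd).mul (continuous_nnTranslate_inv hh)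
  have hb1 : ∀ n x y, φ n y * nnTranslate h (inv y) x ≤ 1 := fun n x y =>
    mul_le_one' ((hφ n).le_one y) (nnTranslate_le_one hh _ _)
  calc ∫⁻ x, ∫⁻ y, nnTranslate h (inv y) x ∂σ ∂ω
      ≤ ∫⁻ x, liminf (fun n => ∫⁻ y, (φ n y * nnTranslate h (inv y) x : ℝ≥0) ∂σ) atTop ∂ω := by
        refine lintegral_mono fun x => ENNReal.le_liminf_of_forall_le_add fun n => ?_
        have hmeas : Measurable fun y => ((φ n y * nnTranslate h (inv y) x : ℝ≥0) : ℝ≥0∞) :=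
          ((hb n).comp (by fun_prop : Continuous fun y : K => (x, y))).measurable.coe_nnreal_ennreal
        refine le_trans ?_ (add_le_add_right (hCσ n).le _)
        rw [← lintegral_indicator_one (MeasurableSet.univ.diff (hC n).measurableSet),
          ← lintegral_add_left hmeas]
        refine lintegral_mono fun y => ?_
        by_cases hy : y ∈ C n
        · simp [hφ1 n y hy]
        · simpa [hy] using le_add_left (ENNReal.coe_le_one_iff.2 (nnTranslate_le_one hh (inv y) x))
    _ ≤ liminf (fun n => ∫⁻ x, ∫⁻ y, (φ n y * nnTranslate h (inv y) x : ℝ≥0) ∂σ ∂ω) atTop :=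
        lintegral_liminf_le fun n => (continuous_lintegral_of_le_one σ (hb n) (hb1 n)).measurable
    _ ≤ ∫⁻ x, h x ∂ω := by
        refine liminf_le_of_frequently_le' (Frequently.of_forall fun n => ?_)
        rw [lintegral_lintegral_swap_of_compact ω σ (hb n)
          (isCompact_setMul ((hφ n).hasCompactSupport.isCompact) hh.hasCompactSupport.isCompact)
          (hφ n).hasCompactSupport.isCompact fun x y hne => ?_]
        · simp only [ENNReal.coe_mul]
          calc ∫⁻ y, ∫⁻ x, (φ n y : ℝ≥0∞) * nnTranslate h (inv y) x ∂ω ∂σ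
              ≤ ∫⁻ _, (∫⁻ x, h x ∂ω) ∂σ := lintegral_mono fun y => by
                rw [lintegral_const_mul' _ _ ENNReal.coe_ne_top, lintegral_nnTranslate hω hh]
                exact mul_le_of_le_one_left' (ENNReal.coe_le_one_iff.2 ((hφ n).le_one y))
            _ = ∫⁻ x, h x ∂ω := by simp
        · have hy : y ∈ tsupport (φ n) := subset_tsupport _ (left_ne_zero_of_mul hne)
          obtain ⟨t, ht, hft⟩ :=
            exists_mem_support_of_nnTranslate_ne_zero (right_ne_zero_of_mul hne)
          refine ⟨mem_setMul.2 ⟨y, hy, t, subset_tsupport _ hft, ?_⟩, hy⟩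
          simpa [inv_inv] using mem_support_inv_conv ht

/-- Mixing is used twice: `convMeasure σ x` is itself a mixture, and its inner approximability comes
from `isInnerApprox_bind` over `σ`. -/
theorem bind_convMeasure_le {ω : Measure K} (hω : IsLeftHaar ω) :
    ω.bind (convMeasure σ) ≤ ω := by
  have := hω.regular
  exact bind_le_of_forall_lintegral_le ω (continuous_lintegral_convMeasure σ)
    (fun x => isInnerApprox_bind σ (continuous_lintegral_conv_inv x)
      fun _ => isInnerApprox_of_regular _) fun h hh => lintegral_convMeasure_le σ hω hh

theorem measurable_convMeasure : Measurable (convMeasure σ) :=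
  measurable_of_isInnerApprox (continuous_lintegral_convMeasure σ)
    fun x => isInnerApprox_bind σ (continuous_lintegral_conv_inv x)
      fun _ => isInnerApprox_of_regular _

end ConvMeasure

theorem lintegral_lintegral_conv_le {ω : Measure K} (hω : IsLeftHaar ω) (z : K) {u : K → ℝ≥0∞}
    (hu : Measurable u) : ∫⁻ y, ∫⁻ t, u t ∂(conv z y : Measure K) ∂ω ≤ ∫⁻ t, u t ∂ω := by
  rw [← Measure.lintegral_bind (measurable_conv z).aemeasurable hu.aemeasurable]
  exact lintegral_mono' (bind_conv_le hω z) le_rfl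

theorem lintegral_lintegral_convMeasure_le (σ : Measure K) [IsProbabilityMeasure σ] [σ.Regular]
    {ω : Measure K} (hω : IsLeftHaar ω) {u : K → ℝ≥0∞} (hu : Measurable u) :
    ∫⁻ x, ∫⁻ t, u t ∂(convMeasure σ x) ∂ω ≤ ∫⁻ t, u t ∂ω := by
  rw [← Measure.lintegral_bind (measurable_convMeasure σ).aemeasurable hu.aemeasurable]
  exact lintegral_mono' (bind_convMeasure_le σ hω) le_rfl

theorem measurable_translate {k : K → ℂ} (hk : Measurable k) (z : K) :
    Measurable (translate k z) := by
  let κ : Kernel K K := ⟨fun y => (conv z y : Measure K), measurable_conv z⟩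
  have : IsMarkovKernel κ := ⟨fun y => inferInstanceAs (IsProbabilityMeasure (conv z y : Measure K))⟩
  exact (StronglyMeasurable.integral_kernel (κ := κ) hk.stronglyMeasurable).measurable

theorem measurable_translate_inv {k : K → ℂ} (hk : Measurable k) (x : K) :
    Measurable fun y => translate k (inv y) x := by
  let κ : Kernel K K := ⟨fun y => (conv (inv y) x : Measure K), measurable_conv_inv x⟩
  have : IsMarkovKernel κ :=
    ⟨fun y => inferInstanceAs (IsProbabilityMeasure (conv (inv y) x : Measure K))⟩
  exact (StronglyMeasurable.integral_kernel (κ := κ) hk.stronglyMeasurable).measurable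

theorem lintegral_enorm_translate_le {ω : Measure K} (hω : IsLeftHaar ω) {k : K → ℂ}
    (hk : Measurable k) (z : K) : ∫⁻ y, ‖translate k z y‖ₑ ∂ω ≤ ∫⁻ t, ‖k t‖ₑ ∂ω :=
  (lintegral_mono fun _ => enorm_integral_le_lintegral_enorm _).trans
    (lintegral_lintegral_conv_le hω z hk.enorm)

theorem enorm_convFun_le (σ : Measure K) {k : K → ℂ} (hk : Measurable k) (x : K) :
    ‖convFun σ k x‖ₑ ≤ ∫⁻ t, ‖k t‖ₑ ∂(convMeasure σ x) := by
  rw [lintegral_convMeasure σ x hk.enorm]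
  exact (enorm_integral_le_lintegral_enorm _).trans
    (lintegral_mono fun y => enorm_integral_le_lintegral_enorm _)

theorem lintegral_enorm_convFun_le (σ : Measure K) [IsProbabilityMeasure σ] [σ.Regular]
    {ω : Measure K} (hω : IsLeftHaar ω) {k : K → ℂ} (hk : Measurable k) :
    ∫⁻ x, ‖convFun σ k x‖ₑ ∂ω ≤ ∫⁻ t, ‖k t‖ₑ ∂ω :=
  (lintegral_mono (enorm_convFun_le σ hk)).trans (lintegral_lintegral_convMeasure_le σ hω hk.enorm)

theorem ae_integrable_conv {ω : Measure K} (hω : IsLeftHaar ω) {k : K → ℂ} (hk : Measurable k)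
    (hki : Integrable k ω) (z : K) : ∀ᵐ y ∂ω, Integrable k (conv z y : Measure K) := by
  have hm : Measurable fun y => ∫⁻ t, ‖k t‖ₑ ∂(conv z y : Measure K) :=
    (Measure.measurable_lintegral hk.enorm).comp (measurable_conv z)
  filter_upwards [ae_lt_top hm ((lintegral_lintegral_conv_le hω z hk.enorm).trans_lt hki.2).ne]
    with y hy
  exact ⟨hk.aestronglyMeasurable, hy⟩

/-- Only almost everywhere: where `k` is not integrable for `δ_z * δ_y`, the integral takes its
default value zero and additivity may fail. -/
theorem translate_sub_ae {ω : Measure K} (hω : IsLeftHaar ω) {k l : K → ℂ} (hk : Measurable k)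
    (hki : Integrable k ω) (hl : Measurable l) (hli : Integrable l ω) (z : K) :
    translate (k - l) z =ᵐ[ω] translate k z - translate l z := by
  filter_upwards [ae_integrable_conv hω hk hki z, ae_integrable_conv hω hl hli z] with y h1 h2
  exact integral_sub h1 h2

theorem ae_integrable_convMeasure (σ : Measure K) [IsProbabilityMeasure σ] [σ.Regular]
    {ω : Measure K} (hω : IsLeftHaar ω) {k : K → ℂ} (hk : Measurable k) (hki : Integrable k ω) :
    ∀ᵐ x ∂ω, (∀ᵐ y ∂σ, Integrable k (conv (inv y) x : Measure K)) ∧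
      Integrable (fun y => translate k (inv y) x) σ := by
  have hm : Measurable fun x => ∫⁻ t, ‖k t‖ₑ ∂(convMeasure σ x) :=
    (Measure.measurable_lintegral hk.enorm).comp (measurable_convMeasure σ)
  filter_upwards [ae_lt_top hm ((lintegral_lintegral_convMeasure_le σ hω hk.enorm).trans_lt
    hki.2).ne] with x hx
  rw [lintegral_convMeasure σ x hk.enorm] at hx
  have hm' : Measurable fun y => ∫⁻ t, ‖k t‖ₑ ∂(conv (inv y) x : Measure K) :=
    (Measure.measurable_lintegral hk.enorm).comp (measurable_conv_inv x)
  refine ⟨(ae_lt_top hm' hx.ne).mono fun y hy => ⟨hk.aestronglyMeasurable, hy⟩,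
    (measurable_translate_inv hk x).aestronglyMeasurable, ?_⟩
  exact (lintegral_mono fun y => enorm_integral_le_lintegral_enorm _).trans_lt hx

theorem convFun_sub_ae (σ : Measure K) [IsProbabilityMeasure σ] [σ.Regular]
    {ω : Measure K} (hω : IsLeftHaar ω) {k l : K → ℂ} (hk : Measurable k)
    (hki : Integrable k ω) (hl : Measurable l) (hli : Integrable l ω) :
    convFun σ (k - l) =ᵐ[ω] convFun σ k - convFun σ l := by
  filter_upwards [ae_integrable_convMeasure σ hω hk hki, ae_integrable_convMeasure σ hω hl hli]
    with x h1 h2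
  rw [Pi.sub_apply, convFun, convFun, convFun, ← integral_sub h1.2 h2.2]
  refine integral_congr_ae ?_
  filter_upwards [h1.1, h2.1] with y h3 h4
  exact integral_sub h3 h4

end Hypergroup

/-! ### Part (b): harmonic `L¹` functions -/

namespace Hypergroup

open Filter Set ProbabilityTheory
open scoped ENNReal NNReal

variable {K : Type*} [TopologicalSpace K] [T2Space K] [LocallyCompactSpace K]
  [MeasurableSpace K] [BorelSpace K] [Hypergroup K]

/-- Joint continuity of `(x, y) ↦ ∫ k(x, s) d(δ_w * δ_y)(s)`. -/
theorem continuous_integral_conv {X : Type*} [TopologicalSpace X] {k : X → K → ℂ}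
    (hk : Continuous k.uncurry) {M : ℝ} (hM : ∀ x s, ‖k x s‖ ≤ M) (w : K) :
    Continuous fun p : X × K => translate (k p.1) w p.2 := by
  have hkx : ∀ x, Continuous (k x) := fun x => hk.comp (by fun_prop : Continuous fun s => (x, s))
  rw [continuous_iff_continuousAt]
  rintro ⟨x₀, y₀⟩
  rw [ContinuousAt, Metric.tendsto_nhds]
  intro ε hε
  -- One compact `C` contains the supports for all `y` near `y₀`, and on `C` the functions `k x` are
  -- uniformly close to `k x₀`.
  obtain ⟨C, hC, hsub⟩ := exists_compact_superset (isCompact_support_conv w y₀)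
  have h1 : ∀ᶠ y in 𝓝 y₀, (conv w y : Measure K).support ⊆ interior C :=
    ((continuous_const.prodMk continuous_id : Continuous fun y : K => (w, y)).tendsto y₀).eventually
      (eventually_support_conv_subset isOpen_interior hsub)
  have h2 : ∀ᶠ x in 𝓝 x₀, ∀ s ∈ C, ‖k x s - k x₀ s‖ < ε / 2 := by
    refine hC.eventually_forall_of_forall_eventually fun s _ => ?_
    have hc : Continuous fun p : X × K => ‖k p.1 p.2 - k x₀ p.2‖ :=
      (hk.sub ((hkx x₀).comp continuous_snd)).norm
    exact hc.continuousAt.eventually_lt_const (by simpa using half_pos hε)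
  have h3 : ∀ᶠ y in 𝓝 y₀, dist (translate (k x₀) w y) (translate (k x₀) w y₀) < ε / 2 :=
    Metric.tendsto_nhds.1 (((continuous_translate (hkx x₀) (hM x₀)).comp
      (by fun_prop : Continuous fun y : K => (w, y))).tendsto y₀) _ (half_pos hε)
  filter_upwards [(continuous_fst.tendsto (x₀, y₀)).eventually h2,
    (continuous_snd.tendsto (x₀, y₀)).eventually (h1.and h3)] with p hp2 hp
  have h4 : dist (translate (k p.1) w p.2) (translate (k x₀) w p.2) ≤ ε / 2 := by
    rw [dist_eq_norm, translate, translate, ← integral_sub (integrable_conv (hkx _) (hM _) _ _)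
      (integrable_conv (hkx _) (hM _) _ _)]
    refine (norm_integral_le_of_norm_le_const (C := ε / 2) ?_).trans (by simp)
    exact (ae_mem_support_conv w p.2).mono fun s hs => (hp2 s (interior_subset (hp.1 hs))).le
  linarith [dist_triangle (translate (k p.1) w p.2) (translate (k x₀) w p.2)
    (translate (k x₀) w y₀), hp.2]

/-- The function `z ↦ ∫ g(y) k(ž * y) dω(y)`. -/
noncomputable def haarPairing (ω : Measure K) (g k : K → ℂ) (z : K) : ℂ :=
  ∫ y, g y * translate k (inv z) y ∂ω

section HaarPairing

variable {ω : Measure K} {g : K → ℂ}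

/-- The bound is uniform in `z`, so `L¹` approximation of `k` by `C_c(K)` becomes uniform
approximation of the pairing. -/
theorem enorm_haarPairing_sub_le (hω : IsLeftHaar ω) (hg : Continuous g) {G : ℝ≥0}
    (hG : ∀ y, ‖g y‖₊ ≤ G) {k l : K → ℂ} (hk : Measurable k)
    (hki : Integrable k ω) (hl : Measurable l) (hli : Integrable l ω) (z : K) :
    ‖haarPairing ω g k z - haarPairing ω g l z‖ₑ ≤ G * ∫⁻ t, ‖k t - l t‖ₑ ∂ω := by
  have hint : ∀ u : K → ℂ, Measurable u → Integrable u ω →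
      Integrable (fun y => g y * translate u (inv z) y) ω := fun u hu hui => by
    refine Integrable.bdd_mul ⟨(measurable_translate hu _).aestronglyMeasurable,
      (lintegral_enorm_translate_le hω hu _).trans_lt hui.2⟩ hg.aestronglyMeasurable
      (c := G) (.of_forall fun y => hG y)
  rw [haarPairing, haarPairing, ← integral_sub (hint k hk hki) (hint l hl hli)]
  refine (enorm_integral_le_lintegral_enorm _).trans ?_
  refine le_trans ?_ (mul_le_mul_right (lintegral_enorm_translate_le hω (hk.sub hl) (inv z)) _)
  rw [← lintegral_const_mul _ (measurable_translate (hk.sub hl) _).enorm]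
  refine lintegral_mono_ae ?_
  filter_upwards [translate_sub_ae hω hk hki hl hli (inv z)] with y hy
  rw [hy, ← mul_sub, enorm_mul]
  exact mul_le_mul_left (ENNReal.coe_le_coe.2 (hG y)) _

theorem continuous_haarPairing [ω.Regular] (hg : Continuous g) (hgc : HasCompactSupport g)
    {h : K → ℂ} (hh : Continuous h) {M : ℝ} (hM : ∀ t, ‖h t‖ ≤ M) :
    Continuous (haarPairing ω g h) :=
  continuous_integral_of_hasCompactSupport_mul ω (f := fun z y => translate h (inv z) y)
    ((continuous_translate hh hM).comp
      ((continuous_inv.comp continuous_fst).prodMk continuous_snd)) hg hgc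

theorem hasCompactSupport_haarPairing (hgc : HasCompactSupport g) {h : K → ℂ}
    (hhc : HasCompactSupport h) : HasCompactSupport (haarPairing ω g h) := by
  refine HasCompactSupport.intro ((isCompact_setMul hhc.isCompact
    (hgc.isCompact.image continuous_inv)).image continuous_inv) fun z hz => ?_
  refine integral_eq_zero_of_ae (.of_forall fun y => ?_)
  by_contra hne
  obtain ⟨h1, h2⟩ := mul_ne_zero_iff.1 hne
  exact hz ⟨_, mem_of_translate_ne_zero (subset_tsupport _ h1) h2, inv_inv z⟩

theorem exists_zeroAtInfty_haarPairing (hω : IsLeftHaar ω) (hg : Continuous g)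
    (hgc : HasCompactSupport g) {k : K → ℂ} (hk : Measurable k) (hki : Integrable k ω) :
    ∃ F : C₀(K, ℂ), ⇑F = haarPairing ω g k := by
  have := hω.regular
  obtain ⟨G, hG⟩ := hg.bounded_above_of_compact_support hgc
  refine exists_zeroAtInfty_of_forall_norm_sub_le fun ε hε => ?_
  have hδ : ENNReal.ofReal (ε / (G.toNNReal + 1)) ≠ 0 :=
    (ENNReal.ofReal_pos.2 (by positivity)).ne'
  obtain ⟨h, hle, hh, hhc⟩ := hki.exists_continuous_lintegral_sub_le hδ
  obtain ⟨M, hM⟩ := hh.bounded_above_of_compact_support hhc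
  refine ⟨haarPairing ω g h, continuous_haarPairing hg hgc hh hM,
    hasCompactSupport_haarPairing hgc hhc, fun z => ?_⟩
  have h1 := enorm_haarPairing_sub_le hω hg (G := G.toNNReal)
    (fun y => NNReal.coe_le_coe.1 ((hG y).trans (Real.le_coe_toNNReal G))) hk hki hh.measurable
    (hh.integrable_of_hasCompactSupport hhc) z
  have h2 := h1.trans (mul_le_mul_right hle _)
  rw [← ENNReal.ofReal_coe_nnreal, ← ENNReal.ofReal_mul (by positivity), ← ofReal_norm,
    ENNReal.ofReal_le_ofReal_iff (by positivity)] at h2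
  refine h2.trans ?_
  rw [mul_div_assoc', div_le_iff₀ (by positivity)]
  nlinarith

theorem continuous_convFun (σ : Measure K) [IsProbabilityMeasure σ] [σ.Regular]
    {h : K → ℂ} (hh : Continuous h) {M : ℝ} (hM : ∀ t, ‖h t‖ ≤ M) : Continuous (convFun σ h) :=
  continuous_integral_of_bounded σ (f := fun x y => translate h (inv y) x)
    ((continuous_translate hh hM).comp
      ((continuous_inv.comp continuous_snd).prodMk continuous_fst))
    fun _ _ => norm_translate_le hM _ _

/-- Averaging `z ↦ ∫ g(y) h(ž * y) dω(y)` on the right by `σ` replaces `h` by `σ * h`. -/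
theorem integral_translate_haarPairing [ω.Regular] (σ : Measure K) [IsProbabilityMeasure σ]
    [σ.Regular] (hg : Continuous g) (hgc : HasCompactSupport g) {h : K → ℂ} (hh : Continuous h)
    {M : ℝ} (hM : ∀ t, ‖h t‖ ≤ M) (z : K) :
    ∫ x, translate (haarPairing ω g h) z x ∂σ = haarPairing ω g (convFun σ h) z := by
  obtain ⟨G, hG⟩ := hg.bounded_above_of_compact_support hgc
  have hG0 : 0 ≤ G := (norm_nonneg _).trans (hG e)
  -- Since `g` lives on a compact set, `ω` may be replaced by a finite regular measure, for which
  -- Fubini holds.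
  set m := ω.restrict (tsupport g)
  have hfin : ω (tsupport g) ≠ ∞ := hgc.isCompact.measure_ne_top
  have : IsFiniteMeasure m := isFiniteMeasure_restrict.2 hfin
  have : m.Regular := Measure.Regular.restrict_of_measure_ne_top hfin
  have hrestr : ∀ u : K → ℂ, ∫ y, g y * u y ∂ω = ∫ y, g y * u y ∂m := fun u =>
    (setIntegral_eq_integral_of_forall_compl_eq_zero fun y hy => by
      rw [image_eq_zero_of_notMem_tsupport hy, zero_mul]).symm
  have hmul : ∀ (u : K → K → ℂ), (∀ x y, ‖u x y‖ ≤ M) → ∀ x y, ‖g y * u x y‖ ≤ G * M :=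
    fun u hu x y => by
      rw [norm_mul]
      exact mul_le_mul (hG y) (hu x y) (norm_nonneg _) hG0
  have hT : Continuous (Function.uncurry fun t y => translate h (inv t) y) :=
    (continuous_translate hh hM).comp ((continuous_inv.comp continuous_fst).prodMk continuous_snd)
  have hstep (x : K) : translate (haarPairing ω g h) z x =
      ∫ y, g y * translate (translate h (inv x)) (inv z) y ∂m := by
    have h1 : haarPairing ω g h = fun t => ∫ y, g y * translate h (inv t) y ∂m :=
      funext fun t => hrestr _
    rw [h1, translate, integral_integral_swap_of_bounded
      (f := fun t y => g y * translate h (inv t) y) _ m ((hg.comp continuous_snd).mul hT)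
      (hmul _ fun _ _ => norm_translate_le hM _ _)]
    refine integral_congr_ae (.of_forall fun y => ?_)
    simp only [integral_const_mul]
    congr 1
    -- Here `(δ_z * δ_x)ˇ = δ_x̌ * δ_ž` moves the involution inside the convolution.
    rw [← translate_translate hh hM, translate, ← map_inv_conv]
    exact (integral_map continuous_inv.measurable.aemeasurable ((continuous_translate hh hM).comp
      (by fun_prop : Continuous fun r : K => (r, y))).aestronglyMeasurable).symm
  have hH : Continuous (Function.uncurry fun x y =>
      translate (translate h (inv x)) (inv z) y) :=
    continuous_integral_conv hT (fun _ _ => norm_translate_le hM _ _) (inv z)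
  simp only [hstep]
  rw [integral_integral_swap_of_bounded
    (f := fun x y => g y * translate (translate h (inv x)) (inv z) y) σ m
    ((hg.comp continuous_snd).mul hH)
    (hmul _ fun _ _ => norm_translate_le (norm_translate_le hM _) _ _), haarPairing, hrestr]
  refine integral_congr_ae (.of_forall fun y => ?_)
  simp only [integral_const_mul]
  congr 1
  exact integral_integral_swap_of_bounded σ _ (f := fun x s => translate h (inv x) s) hT
    fun _ _ => norm_translate_le hM _ _

/-- Replace `k` by a nearby `h ∈ C_c(K)`, for which Fubini gives the identity with `σ * h`. Since `k
= σ * k` and `σ *` is an `L¹` contraction, `σ * h` is as close to `k` as `h` is. -/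
theorem integral_translate_haarPairing_of_harmonic (σ : Measure K) [IsProbabilityMeasure σ]
    [σ.Regular] (hω : IsLeftHaar ω) (hg : Continuous g) (hgc : HasCompactSupport g) {k : K → ℂ}
    (hk : Measurable k) (hki : Integrable k ω) (hharm : convFun σ k =ᵐ[ω] k) (z : K) :
    ∫ x, translate (haarPairing ω g k) z x ∂σ = haarPairing ω g k z := by
  have := hω.regular
  obtain ⟨G', hG'⟩ := hg.bounded_above_of_compact_support hgc
  set G : ℝ≥0 := G'.toNNReal
  have hG : ∀ y, ‖g y‖₊ ≤ G := fun y =>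
    NNReal.coe_le_coe.1 ((hG' y).trans (Real.le_coe_toNNReal G'))
  obtain ⟨F, hF⟩ := exists_zeroAtInfty_haarPairing hω hg hgc hk hki
  have hFc : Continuous (haarPairing ω g k) := hF ▸ map_continuous F
  have hFb : ∀ x, ‖haarPairing ω g k x‖ ≤ ‖F.toBCF‖ := fun x =>
    hF ▸ F.toBCF.norm_coe_le_norm x
  have hslice : ∀ {u : K → ℂ} {B : ℝ}, Continuous u → (∀ x, ‖u x‖ ≤ B) →
      Integrable (translate u z) σ := fun hu hB =>
    .of_bound ((continuous_translate hu hB).comp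
      (by fun_prop : Continuous fun y : K => (z, y))).aestronglyMeasurable _
      (.of_forall (norm_translate_le hB z))
  refine eq_of_forall_dist_le fun ε hε => ?_
  -- Two replacements, of `k` by `h` and by `σ * h`, cost `G * δ` each.
  set δ : ℝ := ε / (2 * G + 1)
  have hδ : 0 < δ := by positivity
  obtain ⟨h, hle, hh, hhc⟩ := hki.exists_continuous_lintegral_sub_le
    (ENNReal.ofReal_pos.2 hδ).ne'
  obtain ⟨M, hM⟩ := hh.bounded_above_of_compact_support hhc
  have hhi := hh.integrable_of_hasCompactSupport (μ := ω) hhc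
  have hreal : ∀ {c : ℂ} {I : ℝ≥0∞}, ‖c‖ₑ ≤ G * I → I ≤ ENNReal.ofReal δ → ‖c‖ ≤ G * δ := by
    intro c I h1 h2
    have h3 := h1.trans (mul_le_mul_right h2 _)
    rwa [← ENNReal.ofReal_coe_nnreal, ← ENNReal.ofReal_mul (by positivity), ← ofReal_norm,
      ENNReal.ofReal_le_ofReal_iff (by positivity)] at h3
  have hd : ∀ w, ‖haarPairing ω g k w - haarPairing ω g h w‖ ≤ G * δ := fun w =>
    hreal (enorm_haarPairing_sub_le hω hg hG hk hki hh.measurable hhi w) hle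
  have hhF := continuous_haarPairing (ω := ω) hg hgc hh hM
  obtain ⟨B, hB⟩ := hhF.bounded_above_of_compact_support (hasCompactSupport_haarPairing hgc hhc)
  have h1 : ‖∫ x, translate (haarPairing ω g k) z x ∂σ -
      ∫ x, translate (haarPairing ω g h) z x ∂σ‖ ≤ G * δ := by
    rw [← integral_sub (hslice hFc hFb) (hslice hhF hB)]
    refine (norm_integral_le_of_norm_le_const (C := G * δ) (.of_forall fun x => ?_)).trans (by simp)
    rw [translate, translate, ← integral_sub (integrable_conv hFc hFb z x)
      (integrable_conv hhF hB z x)]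
    exact (norm_integral_le_of_norm_le_const (.of_forall hd)).trans (by simp)
  have hcm : Measurable (convFun σ h) := (continuous_convFun σ hh hM).measurable
  have hci : Integrable (convFun σ h) ω :=
    ⟨hcm.aestronglyMeasurable, (lintegral_enorm_convFun_le σ hω hh.measurable).trans_lt hhi.2⟩
  have hcd : ∫⁻ t, ‖k t - convFun σ h t‖ₑ ∂ω ≤ ENNReal.ofReal δ := by
    refine le_trans (lintegral_congr_ae ?_).le
      ((lintegral_enorm_convFun_le σ hω (hk.sub hh.measurable)).trans hle)
    filter_upwards [hharm, convFun_sub_ae σ hω hk hki hh.measurable hhi] with t h3 h4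
    rw [h4, Pi.sub_apply, h3]
  have h2 := hreal (enorm_haarPairing_sub_le hω hg hG hk hki hcm hci z) hcd
  rw [← integral_translate_haarPairing σ hg hgc hh hM z, norm_sub_rev] at h2
  rw [dist_eq_norm]
  refine (norm_sub_le_norm_sub_add_norm_sub _ _ _).trans ((add_le_add h1 h2).trans ?_)
  have : δ * (2 * G + 1) = ε := div_mul_cancel₀ _ (by positivity)
  nlinarith

end HaarPairing

theorem harmonicL1_eq_zero [NoncompactSpace K] (σ : Measure K) [IsProbabilityMeasure σ]
    [σ.Regular] (hσ : IsNondegenerate σ) {ω : Measure K} (hω : IsLeftHaar ω) :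
    harmonicL1 ω σ = {0} := by
  have := hω.regular
  refine Subset.antisymm (fun f hf => ?_) (singleton_subset_iff.2 ?_)
  · have hk : Measurable f := (Lp.stronglyMeasurable f).measurable
    have hki : Integrable f ω := L1.integrable_coeFn f
    refine Lp.eq_zero_iff_ae_eq_zero.2
      (hki.ae_eq_zero_of_forall_integral_mul_eq_zero fun g hg hgc => ?_)
    obtain ⟨F, hF⟩ := exists_zeroAtInfty_haarPairing hω hg hgc hk hki
    have h0 := eq_zero_of_harmonic σ hσ F fun z => by
      rw [hF]
      exact integral_translate_haarPairing_of_harmonic σ hω hg hgc hk hki hf z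
    have h1 : haarPairing ω g f e = 0 := by rw [← hF, h0]; rfl
    simpa only [haarPairing, inv_e, translate_e] using h1
  · have h0 : (⇑(0 : Lp ℂ 1 ω)) =ᵐ[ω] 0 := Lp.coeFn_zero ℂ 1 ω
    have hm : Measurable (0 : Lp ℂ 1 ω) := (Lp.stronglyMeasurable _).measurable
    -- The representative of `0` vanishes only `ω`-almost everywhere; the mixture being below `ω`,
    -- it vanishes `convMeasure σ x`-almost everywhere for almost every `x`.
    have hae := Measure.ae_ae_of_ae_bind (measurable_convMeasure σ).aemeasurable
      (Measure.absolutelyContinuous_of_le (bind_convMeasure_le σ hω) h0)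
    filter_upwards [h0, hae] with x hx hxae
    have hle := enorm_convFun_le σ hm x
    rw [lintegral_congr_ae (g := 0) (hxae.mono fun t ht => by
      simpa only [Pi.zero_apply, enorm_eq_zero] using ht)] at hle
    rw [hx]
    exact enorm_eq_zero.1 (le_antisymm (hle.trans_eq lintegral_zero) zero_le)

end Hypergroup

theorem mainTheorem4 {K : Type*} [TopologicalSpace K] [T2Space K] [LocallyCompactSpace K]
    [MeasurableSpace K] [BorelSpace K] [Hypergroup K] [NoncompactSpace K]
    (σ : Measure K) [IsProbabilityMeasure σ] [σ.Regular]
    (hσ : Hypergroup.IsNondegenerate σ) :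
    Hypergroup.harmonicMeasures σ = {0} ∧
      ∀ ω : Measure K, Hypergroup.IsLeftHaar ω → Hypergroup.harmonicL1 ω σ = {0} :=
  ⟨Hypergroup.harmonicMeasures_eq_zero σ hσ, fun _ hω => Hypergroup.harmonicL1_eq_zero σ hσ hω⟩
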